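/- **Theorem 4.2.** Write $a\wedge b=\min\{a,b\}$ and $\mathrm{sgn}(t)=1$ for $t\ge 0$, $\mathrm{sgn}(t)=-1$ for $t<0$. *Hölder ball.* For $m\in\{1,2,\dots\}$ and $\beta,r\in(0,\infty)$, let $\mathcal B^\beta_r([0,1]^m)$ be the set of continuous $g:[0,1]^m\to\mathbb R$ that are $\lceil\beta-1\rceil$ times continuously differentiable on $(0,1)^m$ with uniformly continuous partial derivatives of all orders up to $\lceil\beta-1\rceil$, and satisfy $$\max_{|u|<\beta}\ \sup_{x\in(0,1)^m}|D^u g(x)|+\max_{\beta-1\le|u|<\beta}\ \sup_{x\ne z\in(0,1)^m}\frac{|D^ug(x)-D^ug(z)|}{\|x-z\|_2^{\beta+1-\lceil\beta\rceil}}\le r,$$ where $u$ ranges over multi-indices in $\{0,1,2,\dots\}^m$. *Compositional functions.* Let $\mathcal G^{\mathbf H}_d(d_*,\beta,r)$ be the set of $f:[0,1]^d\to\mathbb R$ of the form $f(x)=g((x_i)_{i\in I})$ with $I\subset\{1,\dots,d\}$, $|I|=d_*$, $g\in\mathcal B^\beta_r([0,1]^{d_*})$ (coordinates in increasing order). Let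 $\mathcal G^{\mathbf{CH}}_d(q,K,d_*,\beta,r)$ be the set of functions $h_q\circ\cdots\circ h_1\circ h_0:[0,1]^d\to\mathbb R$ where $h_0$ has domain $[0,1]^d$, $h_1,\dots,h_q$ have domain $[0,1]^K$, $h_0,\dots,h_{q-1}$ take values in $[0,1]^K$, $h_q$ is real-valued, every component of $h_0$ lies in $\mathcal G^{\mathbf H}_d(d_*,\beta,r)$, and every component of $h_i$, $1\le i\le q$, lies in $\mathcal G^{\mathbf H}_K(d_*,\beta,r)$. (For $q=0$ this is $\mathcal G^{\mathbf H}_d(d_*,\beta,r)$.) *Model.* Let $\mathcal H^{d,\beta,r,\Lambda}_{q,K,d_*}$ be the set of laws $P$ on $[0,1]^d\times\{-1,1\}$ of pairs $(X,Y)$ such that the law of $X$ has a $[0,\Lambda]$-valued Borel density with respect to Lebesgue measure on $[0,1]^d$ and $P(Y=1\mid X=x)=\eta(x)$ for some $[0,1]$-valued $\eta\in\mathcal G^{\mathbf{CH}}_d(q,K,d_*,\beta,r)$. *Risk.* For measurable $f:[0,1]^d\to\mathbb R$ let $\mathcal R_P(f)=P(\mathrm{sgn}(f(X))\ne Y)$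 and $\mathcal E_P(f)=\mathcal R_P(f)-\inf_g\mathcal R_P(g)$, the infimum being over all measurable $g:[0,1]^d\to\mathbb R$. *Claim.* Let $q\ge 0$ and $d_*\ge1$ be integers, $\beta\in(0,\infty)$ and $r\in(\tfrac12,\infty)$. There is a constant $c_{10}\in(0,\infty)$, depending only on $(d_*,\beta,q,r)$, such that for all integers $d,K\ge1$ with $d_*\le d$ and $d_*q\le Kq$, all $\Lambda\in[1,\infty)$ and all integers $n\ge1$, $$\inf_{\hat f_n}\ \sup_{P\in\mathcal H^{d,\beta,r,\Lambda}_{q,K,d_*}}\boldsymbol E_{P^{\otimes n}}\big[\mathcal E_P(\hat f_n)\big]\ \ge\ c_{10}\cdot\Big(\frac1n\Big)^{\frac{\beta(1\wedge\beta)^q}{d_*+2\beta(1\wedge\beta)^q}},$$ where the infimum is over all estimators based on $n$ observations, i.e. all maps $\hat f_n$ from $([0,1]^d\times\{-1,1\})^n$ to the measurable functions $[0,1]^d\to\mathbb R$ for which $s\mapsto\mathcal E_P(\hat f_n(s))$ is measurable for every Borel probability measure $P$ on $[0,1]^d\times\{-1,1\}$ (this includes every estimator that is jointly measurable in the sample and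 the point). -/

import Mathlib

open MeasureTheory
open scoped ENNReal

noncomputable section

namespace Minimax

/-! ### Hölder balls -/

/-- The mixed partial derivative `D^u f = ∂^{|u|} f / (∂x₁^{u₁} ⋯ ∂x_m^{u_m})` at `x`, for a
multi-index `u`: the iterated derivative of order `|u|` evaluated on the list of basis vectors in
which `e_i` occurs exactly `u i` times. -/
def multiDeriv {m : ℕ} (u : Fin m → ℕ) (f : EuclideanSpace ℝ (Fin m) → ℝ)
    (x : EuclideanSpace ℝ (Fin m)) : ℝ :=
  iteratedFDeriv ℝ (∑ i, u i) f x
    (fun j => EuclideanSpace.single (finSigmaFinEquiv.symm j).1 (1 : ℝ))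

/-- `f` (only its values on `Ω` matter) belongs to `C^k(Ω)`, for `Ω` a bounded closed domain:
`f` is continuous on `Ω`, and on the interior of `Ω` it is `k` times continuously
differentiable with uniformly continuous partial derivatives of all orders `≤ k`. -/
def MemC {m : ℕ} (k : ℕ) (Ω : Set (EuclideanSpace ℝ (Fin m)))
    (f : EuclideanSpace ℝ (Fin m) → ℝ) : Prop :=
  ContinuousOn f Ω ∧ ContDiffOn ℝ k f (interior Ω) ∧
    ∀ u : Fin m → ℕ, ∑ i, u i ≤ k → UniformContinuousOn (multiDeriv u f) (interior Ω)

/-- The Hölder-`β` norm on `Ω`, with values in `[0, ∞]`: the largest sup norm of `D^u f`,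
`|u| < β`, plus the largest Hölder quotient of `D^u f`, `β - 1 ≤ |u| < β`, with exponent
`β + 1 - ⌈β⌉` and the Euclidean distance. -/
def holderNorm {m : ℕ} (β : ℝ) (Ω : Set (EuclideanSpace ℝ (Fin m)))
    (f : EuclideanSpace ℝ (Fin m) → ℝ) : ℝ≥0∞ :=
  (⨆ (u : Fin m → ℕ) (_ : ((∑ i, u i : ℕ) : ℝ) < β),
      ⨆ x ∈ interior Ω, ENNReal.ofReal |multiDeriv u f x|) +
  (⨆ (u : Fin m → ℕ) (_ : ((∑ i, u i : ℕ) : ℝ) < β ∧ β - 1 ≤ ((∑ i, u i : ℕ) : ℝ)),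
      ⨆ x ∈ interior Ω, ⨆ z ∈ interior Ω, ⨆ _ : x ≠ z,
        ENNReal.ofReal (|multiDeriv u f x - multiDeriv u f z| / ‖x - z‖ ^ (β + 1 - (⌈β⌉ : ℝ))))

/-- The Hölder ball of radius `r` in `C^{⌈β-1⌉}(Ω)`. -/
def HolderBall {m : ℕ} (β r : ℝ) (Ω : Set (EuclideanSpace ℝ (Fin m))) :
    Set (EuclideanSpace ℝ (Fin m) → ℝ) :=
  {f | MemC ⌈β - 1⌉₊ Ω f ∧ holderNorm β Ω f ≤ ENNReal.ofReal r}

/-- The closed unit cube as a subset of Euclidean space. -/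
def unitCube (m : ℕ) : Set (EuclideanSpace ℝ (Fin m)) :=
  {x | ∀ i, x i ∈ Set.Icc (0 : ℝ) 1}

/-! ### Compositional functions -/

/-- The input space `[0,1]^d` as a type. -/
abbrev Cube (d : ℕ) : Type := Fin d → unitInterval

/-- Functions on `[0,1]^d` of the form `x ↦ g (x_I)` with `|I| = dstar` and `g` in the
Hölder-`β` ball of radius `r` on `[0,1]^dstar`. -/
def GH (d dstar : ℕ) (β r : ℝ) : Set (Cube d → ℝ) :=
  {f | ∃ (I : Finset (Fin d)) (hI : I.card = dstar),
      ∃ g ∈ HolderBall β r (unitCube dstar),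
        ∀ x, f x = g (WithLp.toLp 2 (fun i => (x (I.orderEmbOfFin hI i) : ℝ)))}

/-- Maps `[0,1]^d → [0,1]^K` all of whose components lie in `GH d dstar β r`. -/
def GHVec (d K dstar : ℕ) (β r : ℝ) : Set (Cube d → Cube K) :=
  {h | ∀ j, (fun x => (h x j : ℝ)) ∈ GH d dstar β r}

/-- The maps `h_i ∘ ⋯ ∘ h_1 ∘ h_0 : [0,1]^d → [0,1]^K`, with `h_0 : [0,1]^d → [0,1]^K` and
`h_1, …, h_i : [0,1]^K → [0,1]^K` having all components of Hölder type. -/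
def innerComp (d K dstar : ℕ) (β r : ℝ) : ℕ → Set (Cube d → Cube K)
  | 0 => GHVec d K dstar β r
  | i + 1 => {p | ∃ h ∈ GHVec K K dstar β r, ∃ p' ∈ innerComp d K dstar β r i, p = h ∘ p'}

/-- The class `G^CH` of real functions `h_q ∘ ⋯ ∘ h_1 ∘ h_0` on `[0,1]^d`; for `q = 0` this is
the single real-valued layer `h_0`. -/
def GCH (d q K dstar : ℕ) (β r : ℝ) : Set (Cube d → ℝ) :=
  match q with
  | 0 => GH d dstar β r
  | q' + 1 => {η | ∃ h ∈ GH K dstar β r, ∃ p ∈ innerComp d K dstar β r q', η = h ∘ p}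

/-! ### Data distributions -/

/-- The label set `{-1, 1}`. -/
abbrev Label : Type := ({-1, 1} : Set ℤ)

/-- The label `1`. -/
def Label.pos : Label := ⟨1, by simp⟩

/-- The label `-1`. -/
def Label.neg : Label := ⟨-1, by simp⟩

/-- The law on `{-1, 1}` with mass `t` at `1` and `1 - t` at `-1`, for `t ∈ [0,1]`. -/
def labelLaw (t : ℝ) : Measure Label :=
  ENNReal.ofReal t • Measure.dirac Label.pos + ENNReal.ofReal (1 - t) • Measure.dirac Label.neg

/-- The joint law `P_{η,Q}`: `x` has law `Q` and, given `x`, the label has law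
`labelLaw (η x)`. See `jointLaw_apply` for its values. -/
def jointLaw {d : ℕ} (η : Cube d → ℝ) (Q : Measure (Cube d)) : Measure (Cube d × Label) :=
  Q.bind (fun x => (labelLaw (η x)).map (Prod.mk x))

theorem jointLaw_apply {d : ℕ} {η : Cube d → ℝ} (hη : Measurable η) (Q : Measure (Cube d))
    {S : Set (Cube d × Label)} (hS : MeasurableSet S) :
    jointLaw η Q S = ∫⁻ x, ∫⁻ y, S.indicator 1 (x, y) ∂(labelLaw (η x)) ∂Q := by
  have key : ∀ (x : Cube d) {A : Set (Cube d × Label)}, MeasurableSet A →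
      (labelLaw (η x)).map (Prod.mk x) A = ∫⁻ y, A.indicator 1 (x, y) ∂(labelLaw (η x)) := by
    intro x A hA
    rw [Measure.map_apply measurable_prodMk_left hA,
      ← lintegral_indicator_one (measurable_prodMk_left hA)]
    rfl
  have hmeas : Measurable (fun x => (labelLaw (η x)).map (Prod.mk x)) := by
    refine Measure.measurable_of_measurable_coe _ fun A hA => ?_
    have hA1 : Measurable (A.indicator (1 : Cube d × Label → ℝ≥0∞)) :=
      measurable_one.indicator hA
    have : (fun x => (labelLaw (η x)).map (Prod.mk x) A) = fun x =>
        ENNReal.ofReal (η x) * A.indicator 1 (x, Label.pos) +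
          ENNReal.ofReal (1 - η x) * A.indicator 1 (x, Label.neg) := by
      funext x
      rw [key x hA]
      simp [labelLaw, lintegral_add_measure, lintegral_smul_measure, lintegral_dirac]
    rw [this]
    exact (hη.ennreal_ofReal.mul (hA1.comp measurable_prodMk_right)).add
      ((measurable_const.sub hη).ennreal_ofReal.mul (hA1.comp measurable_prodMk_right))
  rw [jointLaw, Measure.bind_apply hS hmeas.aemeasurable]
  exact lintegral_congr fun x => key x hS

/-- Probability measures on `[0,1]^d` having a `[0,Λ]`-valued Lebesgue density. -/
def BoundedDensity (d : ℕ) (Λ : ℝ) : Set (Measure (Cube d)) :=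
  {Q | IsProbabilityMeasure Q ∧ ∃ f : Cube d → ℝ, Measurable f ∧ (∀ x, f x ∈ Set.Icc 0 Λ) ∧
      Q = volume.withDensity (fun x => ENNReal.ofReal (f x))}

/-- The statistical model: the laws `P_{η,Q}` with `η ∈ G^CH` taking values in `[0,1]` and `Q`
having a density bounded by `Λ`. -/
def Model (d q K dstar : ℕ) (β r Λ : ℝ) : Set (Measure (Cube d × Label)) :=
  {P | ∃ η ∈ GCH d q K dstar β r, (∀ x, η x ∈ Set.Icc (0 : ℝ) 1) ∧
      ∃ Q ∈ BoundedDensity d Λ, P = jointLaw η Q}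

/-! ### Risks and estimators -/

/-- The sign function with `sgn 0 = 1`. -/
def sgn (t : ℝ) : ℤ := if 0 ≤ t then 1 else -1

/-- The 0-1 risk (misclassification error). -/
def risk {d : ℕ} (P : Measure (Cube d × Label)) (f : Cube d → ℝ) : ℝ≥0∞ :=
  P {p | sgn (f p.1) ≠ (p.2 : ℤ)}

/-- The excess 0-1 risk: the risk minus the infimum of the risks of all measurable functions.
For measurable `f` and a probability measure `P` this subtraction is not truncated. -/
def excessRisk {d : ℕ} (P : Measure (Cube d × Label)) (f : Cube d → ℝ) : ℝ≥0∞ :=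
  risk P f - ⨅ g : {g : Cube d → ℝ // Measurable g}, risk P g.1

/-- An estimator based on a sample of size `n`: a map from samples to measurable functions on
`[0,1]^d`, whose excess risk is a measurable function of the sample, so that its expectation makes
sense. Every map that is jointly measurable in the sample and in the point of `[0,1]^d` is of this
kind. -/
structure Estimator (d n : ℕ) where
  toFun : (Fin n → Cube d × Label) → Cube d → ℝ
  measurable_apply : ∀ s, Measurable (toFun s)
  measurable_excessRisk : ∀ P : Measure (Cube d × Label), IsProbabilityMeasure P →
    Measurable (fun s => excessRisk P (toFun s))

/-- The expected excess risk `E_{P^{⊗n}} [excessRisk P f̂_n]`. -/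
def expectedExcessRisk {d n : ℕ} (P : Measure (Cube d × Label)) (T : Estimator d n) : ℝ≥0∞ :=
  ∫⁻ s, excessRisk P (T.toFun s) ∂(Measure.pi (fun _ : Fin n => P))

/-- The minimax expected excess risk over a set of laws, for samples of size `n`. -/
def minimaxRisk {d : ℕ} (n : ℕ) (H : Set (Measure (Cube d × Label))) : ℝ≥0∞ :=
  ⨅ T : Estimator d n, ⨆ P ∈ H, expectedExcessRisk P T

end Minimax

end

namespace Minimax

/-! ### Product measures with product densities -/

/-! The argument is Assouad's hypercube method with uniform covariates. Write `m` for `dstar`, `γ =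
min 1 β`, `B = β γ ^ q`. Choose `m` coordinates, cut their cube into `N ^ m` cells of side `1 / N`,
and put in each cell a smooth bump of height of order `N ^ (-β)`, switched on or off by a bit `w j`.
This sum of bumps lies in the Hölder ball uniformly in `N` and `w`, and serves as every component of
the innermost layer.

Each of the `q` further layers applies `t ↦ c t ^ γ` to one coordinate. These maps fix `0`, are
increasing, and turn a height `N ^ (-b)` into a multiple of `N ^ (-b γ)`, so the composition has
bumps of height `2 δ` of order `N ^ (-B)`: composition raises the bumps without widening them. After
adding `1 / 2 - δ` in the outermost layer, the regression function equals `1 / 2 + δ` or `1 / 2 - δ`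
on the plateau of cell `j`, according to `w j`. The constant fits into the ball because `r > 1 / 2`.

Flipping one bit changes the regression function by at most `2 δ` on a set of volume at most `N ^
(-m)`, hence produces a `χ²` divergence of order `N ^ (-(m + 2 B))`. If `n ≤ N ^ (m + 2 B)`, then
`n` observations cannot determine the bit (`half_le_add_lintegral_jointLaw`). A wrong sign on a
plateau costs `2 δ` times its volume; averaging over the bits (`card_div_four_le_of_flip`,
`le_minimaxRisk_of_cells`) gives excess risk of order `δ`, that is `N ^ (-B)`. The choice `N = ⌈n ^
(1 / (m + 2 B))⌉` yields the rate. -/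

theorem lintegral_prod_pi {Z : Type*} [MeasurableSpace Z] {n : ℕ} (P : Measure Z)
    [IsProbabilityMeasure P] {g : Fin n → Z → ℝ≥0∞} (hg : ∀ i, Measurable (g i)) :
    ∫⁻ s, ∏ i, g i (s i) ∂(Measure.pi fun _ : Fin n => P) = ∏ i, ∫⁻ z, g i z ∂P := by
  have h := ProbabilityTheory.lintegral_prod_eq_prod_lintegral_of_indepFun Finset.univ
    (fun i (s : Fin n → Z) => g i (s i))
    (ProbabilityTheory.iIndepFun_pi (μ := fun _ : Fin n => P) (X := g)
      fun i => (hg i).aemeasurable) fun i => (hg i).comp (measurable_pi_apply i)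
  rw [h]
  refine Finset.prod_congr rfl fun i _ => ?_
  exact (measurePreserving_eval (fun _ : Fin n => P) i).lintegral_comp (hg i)

theorem pi_withDensity {Z : Type*} [MeasurableSpace Z] (n : ℕ) (P : Measure Z)
    [IsProbabilityMeasure P] {l : Z → ℝ≥0∞} (hl : Measurable l)
    [IsProbabilityMeasure (P.withDensity l)] :
    (Measure.pi fun _ : Fin n => P.withDensity l) =
      (Measure.pi fun _ : Fin n => P).withDensity (fun s => ∏ i, l (s i)) := by
  refine Measure.pi_eq fun A hA => ?_
  have hbox : MeasurableSet (Set.univ.pi A) := MeasurableSet.univ_pi hA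
  rw [withDensity_apply _ hbox, ← lintegral_indicator hbox]
  have : (Set.univ.pi A).indicator (fun s : Fin n → Z => ∏ i, l (s i)) =
      fun s => ∏ i, (A i).indicator l (s i) := by
    funext s
    by_cases h : s ∈ Set.univ.pi A
    · rw [Set.indicator_of_mem h]
      exact Finset.prod_congr rfl fun i _ => (Set.indicator_of_mem (h i trivial) l).symm
    · rw [Set.indicator_of_notMem h]
      obtain ⟨i, hi⟩ : ∃ i, s i ∉ A i := by simpa [Set.mem_pi] using h
      exact (Finset.prod_eq_zero (Finset.mem_univ i) (Set.indicator_of_notMem hi l)).symm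
  rw [this, lintegral_prod_pi P fun i => hl.indicator (hA i)]
  refine Finset.prod_congr rfl fun i _ => ?_
  rw [lintegral_indicator (hA i), withDensity_apply _ (hA i)]

/-! ### Testing two hypotheses -/

/-- For `t ≥ 1` this is `(t / 2 - 1) ^ 2 ≥ 0`. It bounds the overlap `∫ min 1 L` of two laws from
below by the second moment of the likelihood ratio `L`. -/
theorem le_min_one_add_sq (t : ℝ≥0∞) : t ≤ min 1 t + t ^ 2 / 4 := by
  rcases le_total t 1 with h | h
  · rw [min_eq_right h]; exact le_self_add
  · rw [min_eq_left h]
    induction t with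
    | top => simp [ENNReal.top_div_of_ne_top]
    | coe t =>
      have h4 : ((4 : NNReal) : ℝ≥0∞) = 4 := rfl
      rw [← h4, ← ENNReal.coe_pow, ← ENNReal.coe_div (by norm_num), ← ENNReal.coe_one,
        ← ENNReal.coe_add, ENNReal.coe_le_coe, ← NNReal.coe_le_coe]
      push_cast
      nlinarith [sq_nonneg ((t : ℝ) - 2)]

/-- The sum of the errors of a test of two laws whose `χ²` divergence is of order `1 / n`. -/
theorem half_le_add_lintegral_pi {Z : Type*} [MeasurableSpace Z] {n : ℕ} (P : Measure Z)
    [IsProbabilityMeasure P] {l : Z → ℝ≥0∞} (hl : Measurable l)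
    [IsProbabilityMeasure (P.withDensity l)] (hl2 : (∫⁻ z, l z ^ 2 ∂P) ^ n ≤ 2)
    {A B : (Fin n → Z) → ℝ≥0∞} (hA : Measurable A) (hB : Measurable B)
    (hAB : ∀ s, 1 ≤ A s + B s) :
    1 / 2 ≤ ∫⁻ s, A s ∂(Measure.pi fun _ : Fin n => P) +
      ∫⁻ s, B s ∂(Measure.pi fun _ : Fin n => P.withDensity l) := by
  set μ := Measure.pi fun _ : Fin n => P
  set L : (Fin n → Z) → ℝ≥0∞ := fun s => ∏ i, l (s i)
  have hL : Measurable L :=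
    Finset.measurable_prod _ fun i _ => hl.comp (measurable_pi_apply i)
  have hone : ∫⁻ s, L s ∂μ = 1 := by
    have h := pi_withDensity n P hl
    have h1 : (Measure.pi fun _ : Fin n => P.withDensity l) Set.univ = 1 := measure_univ
    rw [h, withDensity_apply _ MeasurableSet.univ, setLIntegral_univ] at h1
    exact h1
  have hsq : ∫⁻ s, L s ^ 2 ∂μ ≤ 2 := by
    have : ∀ s, L s ^ 2 = ∏ i, l (s i) ^ 2 := fun s => (Finset.prod_pow _ _ _).symm
    simp_rw [this]
    rw [lintegral_prod_pi P (g := fun _ z => l z ^ 2) fun _ => hl.pow_const 2]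
    simpa using hl2
  -- The density `min 1 L` lies below those of both product laws, so its mass bounds the sum of the
  -- two errors from below. This mass is at least `1 - (∫ L ^ 2) / 4`.
  have hmin : 1 ≤ ∫⁻ s, min 1 (L s) ∂μ + 1 / 2 := by
    calc (1 : ℝ≥0∞) = ∫⁻ s, L s ∂μ := hone.symm
      _ ≤ ∫⁻ s, (min 1 (L s) + L s ^ 2 / 4) ∂μ := lintegral_mono fun s => le_min_one_add_sq _
      _ = ∫⁻ s, min 1 (L s) ∂μ + (∫⁻ s, L s ^ 2 ∂μ) / 4 := by
          rw [lintegral_add_left (measurable_const.min hL)]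
          simp_rw [div_eq_mul_inv]
          rw [lintegral_mul_const _ (hL.pow_const 2)]
      _ ≤ ∫⁻ s, min 1 (L s) ∂μ + 2 / 4 := by gcongr
      _ = ∫⁻ s, min 1 (L s) ∂μ + 1 / 2 := by
          congr 1
          rw [ENNReal.div_eq_div_iff (by norm_num) (by norm_num) (by norm_num) (by norm_num)]
          norm_num
  have hmin' : 1 / 2 ≤ ∫⁻ s, min 1 (L s) ∂μ := by
    have h2 : (1 : ℝ≥0∞) / 2 + 1 / 2 ≤ ∫⁻ s, min 1 (L s) ∂μ + 1 / 2 :=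
      (ENNReal.add_halves 1).trans_le hmin
    exact (ENNReal.add_le_add_iff_right (by norm_num : (1 / 2 : ℝ≥0∞) ≠ ∞)).1 h2
  refine hmin'.trans ?_
  rw [pi_withDensity n P hl, lintegral_withDensity_eq_lintegral_mul _ hL hB,
    ← lintegral_add_left hA]
  refine lintegral_mono fun s => ?_
  calc min 1 (L s) ≤ min 1 (L s) * (A s + B s) := le_mul_of_one_le_right' (hAB s)
    _ = min 1 (L s) * A s + min 1 (L s) * B s := mul_add _ _ _
    _ ≤ 1 * A s + L s * B s := by gcongr <;> simp
    _ = A s + (L * B) s := by simp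

/-! ### Averaging over the vertices of a hypercube -/

/-- Flipping bit `j` is an involution of the hypercube, so the average over `w` of `e w j` is at
least `1 / 4` for each `j`. Summing over `j` and bounding the average over `w` by a uniform bound
gives the claim. -/
theorem card_div_four_le_of_flip {ι : Type*} [Fintype ι] [DecidableEq ι]
    (e : (ι → Bool) → ι → ℝ≥0∞)
    (he : ∀ w j, 1 / 2 ≤ e w j + e (Function.update w j (!w j)) j)
    {M : ℝ≥0∞} (hM : ∀ w, ∑ j, e w j ≤ M) : (Fintype.card ι : ℝ≥0∞) / 4 ≤ M := by
  set N : ℝ≥0∞ := (Fintype.card (ι → Bool) : ℝ≥0∞)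
  have hN0 : N ≠ 0 := by simp [N]
  have hNt : N ≠ ∞ := by simp [N]
  have h1 : ∀ j, N * (1 / 2) ≤ 2 * ∑ w, e w j := by
    intro j
    have hinv : Function.Involutive fun w : ι → Bool => Function.update w j (!w j) := by
      intro w; simp
    have hs : ∑ w : ι → Bool, e (Function.update w j (!w j)) j = ∑ w, e w j :=
      Equiv.sum_comp hinv.toPerm fun w => e w j
    calc N * (1 / 2) = ∑ _w : ι → Bool, (1 / 2 : ℝ≥0∞) := by simp [N]
      _ ≤ ∑ w, (e w j + e (Function.update w j (!w j)) j) := Finset.sum_le_sum fun w _ => he w j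
      _ = 2 * ∑ w, e w j := by rw [Finset.sum_add_distrib, hs, two_mul]
  have h2 : (Fintype.card ι : ℝ≥0∞) * (N * (1 / 2)) ≤ 2 * (N * M) := by
    calc (Fintype.card ι : ℝ≥0∞) * (N * (1 / 2)) = ∑ _j : ι, N * (1 / 2) := by simp
      _ ≤ ∑ j, 2 * ∑ w, e w j := Finset.sum_le_sum fun j _ => h1 j
      _ = 2 * ∑ w, ∑ j, e w j := by rw [← Finset.mul_sum, Finset.sum_comm]
      _ ≤ 2 * ∑ _w : ι → Bool, M := by gcongr with w _; exact hM w
      _ = 2 * (N * M) := by simp [N]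
  have h3 : N * (Fintype.card ι * (1 / 2)) ≤ N * (2 * M) := by
    calc _ = (Fintype.card ι : ℝ≥0∞) * (N * (1 / 2)) := by ring
      _ ≤ _ := h2
      _ = _ := by ring
  rw [ENNReal.mul_le_mul_iff_right hN0 hNt] at h3
  rw [ENNReal.div_le_iff (by norm_num) (by norm_num)]
  calc (Fintype.card ι : ℝ≥0∞) = Fintype.card ι * (1 / 2) * 2 := by
        rw [mul_assoc, ENNReal.div_mul_cancel (by norm_num) (by norm_num), mul_one]
    _ ≤ 2 * M * 2 := by gcongr
    _ = M * 4 := by ring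

/-! ### Joint laws -/

theorem lintegral_labelLaw (t : ℝ) (F : Label → ℝ≥0∞) :
    ∫⁻ y, F y ∂(labelLaw t) =
      ENNReal.ofReal t * F Label.pos + ENNReal.ofReal (1 - t) * F Label.neg := by
  simp [labelLaw, lintegral_add_measure, lintegral_smul_measure, lintegral_dirac]

theorem lintegral_jointLaw {d : ℕ} {η : Cube d → ℝ} (hη : Measurable η) (Q : Measure (Cube d))
    {F : Cube d × Label → ℝ≥0∞} (hF : Measurable F) :
    ∫⁻ p, F p ∂(jointLaw η Q) =
      ∫⁻ x, (ENNReal.ofReal (η x) * F (x, Label.pos) +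
        ENNReal.ofReal (1 - η x) * F (x, Label.neg)) ∂Q := by
  have hval : ∀ (x : Cube d) {G : Cube d × Label → ℝ≥0∞}, Measurable G →
      ∫⁻ p, G p ∂((labelLaw (η x)).map (Prod.mk x)) =
        ENNReal.ofReal (η x) * G (x, Label.pos) +
          ENNReal.ofReal (1 - η x) * G (x, Label.neg) := by
    intro x G hG
    rw [lintegral_map hG measurable_prodMk_left, lintegral_labelLaw]
  have hmeas : Measurable (fun x => (labelLaw (η x)).map (Prod.mk x)) := by
    refine Measure.measurable_of_measurable_coe _ fun A hA => ?_
    have hA1 : Measurable (A.indicator (1 : Cube d × Label → ℝ≥0∞)) := measurable_one.indicator hA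
    simp_rw [← lintegral_indicator_one hA]
    simp_rw [hval _ hA1]
    exact (hη.ennreal_ofReal.mul (hA1.comp measurable_prodMk_right)).add
      ((measurable_const.sub hη).ennreal_ofReal.mul (hA1.comp measurable_prodMk_right))
  rw [jointLaw, Measure.lintegral_bind hmeas.aemeasurable hF.aemeasurable]
  exact lintegral_congr fun x => hval x hF

theorem isProbabilityMeasure_jointLaw {d : ℕ} {η : Cube d → ℝ} (hη : Measurable η)
    (h01 : ∀ x, η x ∈ Set.Icc (0 : ℝ) 1) (Q : Measure (Cube d)) [IsProbabilityMeasure Q] :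
    IsProbabilityMeasure (jointLaw η Q) := by
  constructor
  rw [← lintegral_one, lintegral_jointLaw hη Q measurable_const]
  have : ∀ x, ENNReal.ofReal (η x) * 1 + ENNReal.ofReal (1 - η x) * 1 = 1 := by
    intro x
    rw [mul_one, mul_one, ← ENNReal.ofReal_add (h01 x).1 (by linarith [(h01 x).2])]
    simp
  simp only [this, lintegral_one, measure_univ]

/-- The likelihood ratio of two joint laws with the same marginal law. -/
noncomputable def likelihoodRatio {d : ℕ} (η η' : Cube d → ℝ) (p : Cube d × Label) : ℝ≥0∞ :=
  if p.2 = Label.pos then ENNReal.ofReal (η' p.1 / η p.1)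
  else ENNReal.ofReal ((1 - η' p.1) / (1 - η p.1))

theorem Label.neg_ne_pos : Label.neg ≠ Label.pos := by
  intro h
  have := congrArg Subtype.val h
  simp [Label.neg, Label.pos] at this

theorem measurable_likelihoodRatio {d : ℕ} {η η' : Cube d → ℝ} (hη : Measurable η)
    (hη' : Measurable η') : Measurable (likelihoodRatio η η') := by
  refine Measurable.ite (measurable_snd (measurableSet_singleton Label.pos)) ?_ ?_
  · exact ((hη'.comp measurable_fst).div (hη.comp measurable_fst)).ennreal_ofReal
  · exact ((measurable_const.sub (hη'.comp measurable_fst)).div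
      (measurable_const.sub (hη.comp measurable_fst))).ennreal_ofReal

/-- Since `η` avoids `0` and `1`, neither quotient in the likelihood ratio has a vanishing
denominator. -/
theorem jointLaw_withDensity {d : ℕ} {η η' : Cube d → ℝ} (hη : Measurable η)
    (hη' : Measurable η') (h : ∀ x, η x ∈ Set.Ioo (0 : ℝ) 1) (Q : Measure (Cube d)) :
    (jointLaw η Q).withDensity (likelihoodRatio η η') = jointLaw η' Q := by
  ext S hS
  have hm := measurable_likelihoodRatio hη hη'
  have h1 : Measurable (S.indicator (1 : Cube d × Label → ℝ≥0∞)) := measurable_one.indicator hS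
  rw [withDensity_apply _ hS, ← lintegral_indicator hS,
    lintegral_jointLaw hη Q (hm.indicator hS), ← lintegral_indicator_one hS,
    lintegral_jointLaw hη' Q h1]
  refine lintegral_congr fun x => ?_
  have hx := h x
  have e1 : ENNReal.ofReal (η x) * ENNReal.ofReal (η' x / η x) = ENNReal.ofReal (η' x) := by
    rw [← ENNReal.ofReal_mul hx.1.le, mul_div_cancel₀ _ hx.1.ne']
  have e2 : ENNReal.ofReal (1 - η x) * ENNReal.ofReal ((1 - η' x) / (1 - η x)) =
      ENNReal.ofReal (1 - η' x) := by
    have : 0 < 1 - η x := by linarith [hx.2]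
    rw [← ENNReal.ofReal_mul this.le, mul_div_cancel₀ _ this.ne']
  congr 1
  · by_cases hp : (x, Label.pos) ∈ S <;> simp [hp, likelihoodRatio, e1]
  · by_cases hp : (x, Label.neg) ∈ S <;> simp [hp, likelihoodRatio, e2, Label.neg_ne_pos]

/-- Given `x`, the second moment is exactly `1 + (η' - η) ^ 2 / (η (1 - η))`, and `η (1 - η) ≥ 3 /
16 ≥ 1 / 6` on `[1 / 4, 3 / 4]`. -/
theorem lintegral_likelihoodRatio_sq_le {d : ℕ} {η η' : Cube d → ℝ} (hη : Measurable η)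
    (hη' : Measurable η') (h : ∀ x, η x ∈ Set.Icc (1 / 4 : ℝ) (3 / 4))
    (h' : ∀ x, η' x ∈ Set.Icc (1 / 4 : ℝ) (3 / 4)) (Q : Measure (Cube d))
    [IsProbabilityMeasure Q] {S : Set (Cube d)} (hS : MeasurableSet S) {a : ℝ}
    (hout : ∀ x ∉ S, η' x = η x) (hin : ∀ x ∈ S, |η' x - η x| ≤ a) :
    ∫⁻ p, likelihoodRatio η η' p ^ 2 ∂(jointLaw η Q) ≤
      1 + ENNReal.ofReal (6 * a ^ 2) * Q S := by
  rw [lintegral_jointLaw hη Q ((measurable_likelihoodRatio hη hη').pow_const 2)]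
  calc _ ≤ ∫⁻ x, (1 + S.indicator (fun _ => ENNReal.ofReal (6 * a ^ 2)) x) ∂Q := by
        refine lintegral_mono fun x => ?_
        obtain ⟨hx1, hx2⟩ := h x
        obtain ⟨hx1', hx2'⟩ := h' x
        have p0 : 0 < η x := by linarith
        have p1 : 0 < 1 - η x := by linarith
        have p0' : 0 ≤ η' x / η x := by apply div_nonneg <;> linarith
        have p1' : 0 ≤ (1 - η' x) / (1 - η x) := by apply div_nonneg <;> linarith
        have e : η x * (η' x / η x) ^ 2 + (1 - η x) * ((1 - η' x) / (1 - η x)) ^ 2 =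
            1 + (η' x - η x) ^ 2 / (η x * (1 - η x)) := by
          field_simp; ring
        have hb : (η' x - η x) ^ 2 / (η x * (1 - η x)) ≤ 6 * (η' x - η x) ^ 2 := by
          rw [div_le_iff₀ (mul_pos p0 p1)]
          have : 1 ≤ 6 * (η x * (1 - η x)) := by nlinarith
          nlinarith [sq_nonneg (η' x - η x)]
        simp only [likelihoodRatio, if_true, if_neg Label.neg_ne_pos]
        rw [← ENNReal.ofReal_pow p0', ← ENNReal.ofReal_pow p1', ← ENNReal.ofReal_mul p0.le,
          ← ENNReal.ofReal_mul p1.le, ← ENNReal.ofReal_add (by positivity) (by positivity), e]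
        by_cases hxS : x ∈ S
        · rw [Set.indicator_of_mem hxS, ← ENNReal.ofReal_one,
            ← ENNReal.ofReal_add zero_le_one (by positivity)]
          refine ENNReal.ofReal_le_ofReal ?_
          have : (η' x - η x) ^ 2 ≤ a ^ 2 := by
            rw [← sq_abs]; gcongr; exact hin x hxS
          linarith
        · simp [Set.indicator_of_notMem hxS, hout x hxS]
    _ = _ := by
        rw [lintegral_add_left measurable_const, lintegral_indicator hS]
        simp

/-- Two joint laws with close regression functions cannot be told apart by `n` observations. -/
theorem half_le_add_lintegral_jointLaw {d n : ℕ} {η η' : Cube d → ℝ} (hη : Measurable η)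
    (hη' : Measurable η') (h : ∀ x, η x ∈ Set.Icc (1 / 4 : ℝ) (3 / 4))
    (h' : ∀ x, η' x ∈ Set.Icc (1 / 4 : ℝ) (3 / 4)) (Q : Measure (Cube d))
    [IsProbabilityMeasure Q] {S : Set (Cube d)} (hS : MeasurableSet S) {a b : ℝ}
    (hout : ∀ x ∉ S, η' x = η x) (hin : ∀ x ∈ S, |η' x - η x| ≤ a)
    (hQ : Q S ≤ ENNReal.ofReal b) (hb : 0 ≤ b) (hn : n * (6 * a ^ 2 * b) ≤ 1 / 2)
    {A B : (Fin n → Cube d × Label) → ℝ≥0∞} (hA : Measurable A) (hB : Measurable B)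
    (hAB : ∀ s, 1 ≤ A s + B s) :
    1 / 2 ≤ ∫⁻ s, A s ∂(Measure.pi fun _ : Fin n => jointLaw η Q) +
      ∫⁻ s, B s ∂(Measure.pi fun _ : Fin n => jointLaw η' Q) := by
  have hI : ∀ x, η x ∈ Set.Ioo (0 : ℝ) 1 := fun x =>
    ⟨by linarith [(h x).1], by linarith [(h x).2]⟩
  have := isProbabilityMeasure_jointLaw hη (fun x => ⟨(hI x).1.le, (hI x).2.le⟩) Q
  have := isProbabilityMeasure_jointLaw hη'
    (fun x => ⟨by linarith [(h' x).1], by linarith [(h' x).2]⟩) Q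
  have hd := jointLaw_withDensity hη hη' hI Q
  rw [← hd] at this ⊢
  refine half_le_add_lintegral_pi _ (measurable_likelihoodRatio hη hη') ?_ hA hB hAB
  have hchi : ∫⁻ p, likelihoodRatio η η' p ^ 2 ∂(jointLaw η Q) ≤
      ENNReal.ofReal (1 + 6 * a ^ 2 * b) := by
    refine (lintegral_likelihoodRatio_sq_le hη hη' h h' Q hS hout hin).trans ?_
    rw [ENNReal.ofReal_add zero_le_one (by positivity), ENNReal.ofReal_one,
      ENNReal.ofReal_mul (p := 6 * a ^ 2) (by positivity)]
    gcongr
  calc (∫⁻ p, likelihoodRatio η η' p ^ 2 ∂(jointLaw η Q)) ^ n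
      ≤ ENNReal.ofReal (1 + 6 * a ^ 2 * b) ^ n := by gcongr
    _ = ENNReal.ofReal ((1 + 6 * a ^ 2 * b) ^ n) := by rw [ENNReal.ofReal_pow (by positivity)]
    _ ≤ ENNReal.ofReal 2 := by
        refine ENNReal.ofReal_le_ofReal ?_
        -- The second moment of the product is at most `exp (n * (6 * a ^ 2 * b)) ≤ exp (1 / 2) ≤
        -- 2`.
        have h1 : (1 + 6 * a ^ 2 * b) ^ n ≤ Real.exp (6 * a ^ 2 * b) ^ n := by
          gcongr
          linarith [Real.add_one_le_exp (6 * a ^ 2 * b)]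
        rw [← Real.exp_nat_mul] at h1
        have h2 : Real.exp (1 / 2) ^ 2 = Real.exp 1 := by
          rw [← Real.exp_nat_mul]; norm_num
        have h3 := Real.exp_one_lt_d9
        have h4 : Real.exp (1 / 2) ≤ 2 := by nlinarith [Real.exp_pos (1 / 2)]
        exact h1.trans ((Real.exp_le_exp.2 hn).trans h4)
    _ = 2 := by simp

/-! ### Risks -/

/-- The label encoded by a Boolean. -/
def Label.ofBool (b : Bool) : Label := if b then Label.pos else Label.neg

theorem measurable_sgn : Measurable sgn :=
  Measurable.ite measurableSet_Ici measurable_const measurable_const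

theorem measurableSet_sgn_ne {d : ℕ} {f : Cube d → ℝ} (hf : Measurable f) (y : ℤ) :
    MeasurableSet {x | sgn (f x) ≠ y} :=
  (measurable_sgn.comp hf (measurableSet_singleton y)).compl

theorem measurableSet_sgn_ne_label {d : ℕ} {f : Cube d → ℝ} (hf : Measurable f) :
    MeasurableSet {p : Cube d × Label | sgn (f p.1) ≠ (p.2 : ℤ)} :=
  (measurableSet_eq_fun (measurable_sgn.comp (hf.comp measurable_fst))
    (measurable_subtype_coe.comp measurable_snd)).compl

theorem risk_jointLaw {d : ℕ} {η : Cube d → ℝ} (hη : Measurable η) (Q : Measure (Cube d))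
    {f : Cube d → ℝ} (hf : Measurable f) :
    risk (jointLaw η Q) f =
      ∫⁻ x, (if 0 ≤ f x then ENNReal.ofReal (1 - η x) else ENNReal.ofReal (η x)) ∂Q := by
  have hS := measurableSet_sgn_ne_label hf
  rw [risk, ← lintegral_indicator_one hS,
    lintegral_jointLaw hη Q (measurable_one.indicator hS)]
  refine lintegral_congr fun x => ?_
  by_cases h : 0 ≤ f x <;> simp [Set.indicator, sgn, h, Label.pos, Label.neg]

/-- The excess risk dominates the misclassification on disjoint sets where the regression function
is far from `1 / 2`. -/
theorem sum_le_excessRisk {d : ℕ} {ι : Type*} [Fintype ι] {η : Cube d → ℝ} (hη : Measurable η)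
    (h01 : ∀ x, η x ∈ Set.Icc (0 : ℝ) 1) (Q : Measure (Cube d)) [IsProbabilityMeasure Q]
    {S : ι → Set (Cube d)} (hS : ∀ j, MeasurableSet (S j))
    (hdisj : Pairwise fun i j => Disjoint (S i) (S j)) {δ : ℝ} (hδ : 0 ≤ δ) (w : ι → Bool)
    (hpos : ∀ j, w j = true → ∀ x ∈ S j, η x = 1 / 2 + δ)
    (hneg : ∀ j, w j = false → ∀ x ∈ S j, η x = 1 / 2 - δ)
    {f : Cube d → ℝ} (hf : Measurable f) :
    ∑ j, ENNReal.ofReal (2 * δ) * Q (S j ∩ {x | sgn (f x) ≠ (Label.ofBool (w j) : ℤ)}) ≤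
      excessRisk (jointLaw η Q) f := by
  have := isProbabilityMeasure_jointLaw hη h01 Q
  -- The Bayes classifier. Its optimality is not needed: the infimum of the risks is at most its
  -- risk, and subtracting more only lowers the excess.
  set g : Cube d → ℝ := fun x => η x - 1 / 2
  have hg : Measurable g := hη.sub_const _
  have hle : ⨅ g : {g : Cube d → ℝ // Measurable g}, risk (jointLaw η Q) g.1 ≤
      risk (jointLaw η Q) g := iInf_le_of_le ⟨g, hg⟩ le_rfl
  have hfin : risk (jointLaw η Q) g ≠ ∞ := measure_ne_top _ _
  refine ENNReal.le_sub_of_add_le_left (hle.trans_lt hfin.lt_top).ne ?_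
  refine (add_le_add_left hle _).trans ?_
  set W : ι → Set (Cube d) := fun j => S j ∩ {x | sgn (f x) ≠ (Label.ofBool (w j) : ℤ)}
  have hW : ∀ j, MeasurableSet (W j) := fun j => (hS j).inter (measurableSet_sgn_ne hf _)
  have hsum : ∑ j, ENNReal.ofReal (2 * δ) * Q (W j) =
      ∫⁻ x, ∑ j, (W j).indicator (fun _ => ENNReal.ofReal (2 * δ)) x ∂Q := by
    rw [lintegral_finsetSum _ fun j _ => measurable_const.indicator (hW j)]
    refine Finset.sum_congr rfl fun j _ => ?_
    rw [lintegral_indicator (hW j), setLIntegral_const]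
  rw [hsum, risk_jointLaw hη Q hf, risk_jointLaw hη Q hg, ← lintegral_add_right _
    (Finset.measurable_fun_sum _ fun j _ => measurable_const.indicator (hW j))]
  refine lintegral_mono fun x => ?_
  obtain ⟨h0, h1⟩ := h01 x
  by_cases hx : ∃ j, x ∈ W j
  · obtain ⟨j, hj⟩ := hx
    have hother : ∀ i ∈ Finset.univ, i ≠ j →
        (W i).indicator (fun _ => ENNReal.ofReal (2 * δ)) x = 0 := by
      intro i _ hij
      refine Set.indicator_of_notMem (fun hi => ?_) _
      exact Set.disjoint_left.1 (hdisj hij) hi.1 hj.1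
    rw [Finset.sum_eq_single j hother (by simp), Set.indicator_of_mem hj]
    cases hb : w j with
    | true =>
      have he := hpos j hb x hj.1
      have hfx : ¬ 0 ≤ f x := by
        intro h
        apply hj.2
        simp [sgn, h, hb, Label.ofBool, Label.pos]
      have hgx : 0 ≤ g x := by simp only [g]; linarith
      rw [if_neg hfx, if_pos hgx, ← ENNReal.ofReal_add (by linarith) (by linarith)]
      exact ENNReal.ofReal_le_ofReal (by linarith)
    | false =>
      have he := hneg j hb x hj.1
      have hfx : 0 ≤ f x := by
        by_contra h
        apply hj.2
        simp [sgn, h, hb, Label.ofBool, Label.neg]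
      rw [if_pos hfx]
      split_ifs with hgx
      · have : δ = 0 := by simp only [g] at hgx; linarith
        simp [this]
      · rw [← ENNReal.ofReal_add (by linarith) (by linarith)]
        exact ENNReal.ofReal_le_ofReal (by linarith)
  · push Not at hx
    rw [Finset.sum_eq_zero fun j _ => Set.indicator_of_notMem (hx j) _, add_zero]
    simp only [g]
    split_ifs <;> exact ENNReal.ofReal_le_ofReal (by linarith)

/-- The conditional probability that `sgn f` differs from the label `b` on `S`. -/
noncomputable def localLoss {d : ℕ} (S : Set (Cube d)) (b : Bool) (f : Cube d → ℝ) : ℝ≥0∞ :=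
  ProbabilityTheory.cond volume S {x | sgn (f x) ≠ (Label.ofBool b : ℤ)}

/-- At every point the sign of `f` is wrong for one of the two labels, so the two error events cover
the space. -/
theorem one_le_localLoss_add {d : ℕ} {S : Set (Cube d)} (hS : volume S ≠ 0) (b : Bool)
    (f : Cube d → ℝ) : 1 ≤ localLoss S b f + localLoss S (!b) f := by
  have := ProbabilityTheory.cond_isProbabilityMeasure hS
  have hu : {x | sgn (f x) ≠ (Label.ofBool b : ℤ)} ∪ {x | sgn (f x) ≠ (Label.ofBool (!b) : ℤ)} =
      Set.univ := by
    ext x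
    cases b <;> by_cases h : 0 ≤ f x <;>
      simp [sgn, h, not_le.1, Label.ofBool, Label.pos, Label.neg]
  calc (1 : ℝ≥0∞) = ProbabilityTheory.cond volume S Set.univ := measure_univ.symm
    _ ≤ _ := by rw [← hu]; exact measure_union_le _ _

/-- When the label is constant, a constant classifier has risk zero, so the excess risk is a plain
error probability. -/
theorem excessRisk_map_const_label {d : ℕ} (Q : Measure (Cube d)) (b : Bool)
    {f : Cube d → ℝ} (hf : Measurable f) :
    excessRisk (Q.map fun x => (x, Label.ofBool b)) f =
      Q {x | sgn (f x) ≠ (Label.ofBool b : ℤ)} := by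
  have hrisk : ∀ g : Cube d → ℝ, Measurable g →
      risk (Q.map fun x => (x, Label.ofBool b)) g = Q {x | sgn (g x) ≠ (Label.ofBool b : ℤ)} := by
    intro g hg
    rw [risk, Measure.map_apply (by fun_prop) (measurableSet_sgn_ne_label hg)]
    rfl
  have hinf : ⨅ g : {g : Cube d → ℝ // Measurable g},
      risk (Q.map fun x => (x, Label.ofBool b)) g.1 = 0 := by
    refine le_antisymm (iInf_le_of_le ⟨fun _ => if b then 1 else -1, measurable_const⟩ ?_) zero_le
    rw [hrisk _ measurable_const]
    cases b <;> simp [sgn, Label.ofBool, Label.pos, Label.neg]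
  rw [excessRisk, hinf, tsub_zero, hrisk f hf]

/-- An estimator need not be jointly measurable. However, the local loss is itself an excess risk,
for the law with uniform covariate on `S` and constant label, and these are measurable by
definition. -/
theorem Estimator.measurable_localLoss {d n : ℕ} (T : Estimator d n) {S : Set (Cube d)}
    (hS : volume S ≠ 0) (b : Bool) : Measurable fun s => localLoss S b (T.toFun s) := by
  have := ProbabilityTheory.cond_isProbabilityMeasure hS
  have hm : Measurable fun x : Cube d => (x, Label.ofBool b) := by fun_prop
  have h := T.measurable_excessRisk ((ProbabilityTheory.cond volume S).map
    fun x => (x, Label.ofBool b)) (Measure.isProbabilityMeasure_map hm.aemeasurable)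
  simp only [excessRisk_map_const_label _ b (T.measurable_apply _)] at h
  exact h

/-- Assouad's lower bound for classification with uniformly distributed covariates, for a
family of regression functions indexed by the vertices of a hypercube. -/
theorem le_minimaxRisk_of_cells {d n : ℕ} {ι : Type*} [Fintype ι] [DecidableEq ι]
    (η : (ι → Bool) → Cube d → ℝ) (hη : ∀ w, Measurable (η w))
    {S B : ι → Set (Cube d)} (hS : ∀ j, MeasurableSet (S j)) (hB : ∀ j, MeasurableSet (B j))
    (hdisj : Pairwise fun i j => Disjoint (S i) (S j)) {δ a b : ℝ} (hδ : 0 ≤ δ) (hδ' : δ ≤ 1 / 4)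
    (hrange : ∀ w x, η w x ∈ Set.Icc (1 / 2 - δ) (1 / 2 + δ))
    (hpos : ∀ w j, w j = true → ∀ x ∈ S j, η w x = 1 / 2 + δ)
    (hneg : ∀ w j, w j = false → ∀ x ∈ S j, η w x = 1 / 2 - δ)
    (hout : ∀ w j, ∀ x ∉ B j, η (Function.update w j (!w j)) x = η w x)
    (ha : 0 < a) (hSa : ∀ j, volume (S j) = ENNReal.ofReal a)
    (hb : 0 ≤ b) (hBb : ∀ j, volume (B j) ≤ ENNReal.ofReal b)
    (hn : n * (6 * (2 * δ) ^ 2 * b) ≤ 1 / 2) {H : Set (Measure (Cube d × Label))}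
    (hH : ∀ w, jointLaw (η w) volume ∈ H) :
    ENNReal.ofReal (Fintype.card ι * a * δ / 2) ≤ minimaxRisk n H := by
  refine le_iInf fun T => ?_
  have hS0 : ∀ j, volume (S j) ≠ 0 := by
    intro j; rw [hSa j]; simpa using ha
  have hq : ∀ w x, η w x ∈ Set.Icc (1 / 4 : ℝ) (3 / 4) := fun w x =>
    ⟨by linarith [(hrange w x).1], by linarith [(hrange w x).2]⟩
  have h01 : ∀ w x, η w x ∈ Set.Icc (0 : ℝ) 1 := fun w x =>
    ⟨by linarith [(hq w x).1], by linarith [(hq w x).2]⟩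
  set e : (ι → Bool) → ι → ℝ≥0∞ := fun w j =>
    ∫⁻ s, localLoss (S j) (w j) (T.toFun s)
      ∂(Measure.pi fun _ : Fin n => jointLaw (η w) volume)
  -- The cost of a wrong sign on a whole plateau: `|2 η - 1| = 2 δ` there, and its volume is `a`.
  set κ : ℝ≥0∞ := ENNReal.ofReal (2 * δ) * ENNReal.ofReal a
  have hflip : ∀ w j, 1 / 2 ≤ e w j + e (Function.update w j (!w j)) j := by
    intro w j
    refine half_le_add_lintegral_jointLaw (hη _) (hη _) (hq _) (hq _) volume (hB j)
      (hout w j) (a := 2 * δ) (fun x _ => ?_) (hBb j) hb hn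
      (T.measurable_localLoss (hS0 j) _) (T.measurable_localLoss (hS0 j) _) fun s => ?_
    · have h1 := hrange w x
      have h2 := hrange (Function.update w j (!w j)) x
      rw [abs_le]
      constructor <;> linarith [h1.1, h1.2, h2.1, h2.2]
    · simpa using one_le_localLoss_add (hS0 j) (w j) (T.toFun s)
  have hrisk : ∀ w, κ * ∑ j, e w j ≤ expectedExcessRisk (jointLaw (η w) volume) T := by
    intro w
    rw [expectedExcessRisk, ← lintegral_finsetSum _ fun j _ => T.measurable_localLoss (hS0 j) _,
      ← lintegral_const_mul _
        (Finset.measurable_fun_sum _ fun j _ => T.measurable_localLoss (hS0 j) _)]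
    refine lintegral_mono fun s => ?_
    refine le_trans (le_of_eq ?_) (sum_le_excessRisk (hη w) (h01 w) volume hS hdisj hδ w
      (hpos w) (hneg w) (T.measurable_apply s))
    rw [Finset.mul_sum]
    refine Finset.sum_congr rfl fun j _ => ?_
    rw [← ProbabilityTheory.cond_mul_eq_inter (hS j), hSa j]
    simp only [κ, localLoss]
    ring
  have key : (Fintype.card ι : ℝ≥0∞) / 4 ≤
      ⨆ w, ∑ j, e w j := card_div_four_le_of_flip e hflip fun w => le_iSup (fun w => ∑ j, e w j) w
  calc ENNReal.ofReal (Fintype.card ι * a * δ / 2)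
      = κ * ((Fintype.card ι : ℝ≥0∞) / 4) := by
        have h4 : (Fintype.card ι : ℝ≥0∞) / 4 = ENNReal.ofReal (Fintype.card ι / 4) := by
          rw [ENNReal.ofReal_div_of_pos (by norm_num)]
          simp
        simp only [κ]
        rw [h4, ← ENNReal.ofReal_mul (by positivity), ← ENNReal.ofReal_mul (by positivity)]
        congr 1; ring
    _ ≤ κ * ⨆ w, ∑ j, e w j := by gcongr
    _ = ⨆ w, κ * ∑ j, e w j := ENNReal.mul_iSup _ _
    _ ≤ _ := iSup_le fun w => (hrisk w).trans
        (le_iSup₂ (f := fun P (_ : P ∈ H) => expectedExcessRisk P T) _ (hH w))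

/-! ### Membership in Hölder balls -/

theorem abs_multiDeriv_le {m : ℕ} (u : Fin m → ℕ) (f : EuclideanSpace ℝ (Fin m) → ℝ)
    (x : EuclideanSpace ℝ (Fin m)) :
    |multiDeriv u f x| ≤ ‖iteratedFDeriv ℝ (∑ i, u i) f x‖ := by
  refine ((iteratedFDeriv ℝ (∑ i, u i) f x).le_opNorm _).trans ?_
  simp

theorem abs_multiDeriv_sub_le {m : ℕ} (u : Fin m → ℕ) (f : EuclideanSpace ℝ (Fin m) → ℝ)
    (x z : EuclideanSpace ℝ (Fin m)) :
    |multiDeriv u f x - multiDeriv u f z| ≤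
      ‖iteratedFDeriv ℝ (∑ i, u i) f x - iteratedFDeriv ℝ (∑ i, u i) f z‖ := by
  refine le_trans ?_ ((iteratedFDeriv ℝ (∑ i, u i) f x -
    iteratedFDeriv ℝ (∑ i, u i) f z).le_opNorm
      (fun j => EuclideanSpace.single (finSigmaFinEquiv.symm j).1 (1 : ℝ))) |>.trans ?_
  · simp [multiDeriv]
  · simp

theorem multiDeriv_of_sum_eq_zero {m : ℕ} {u : Fin m → ℕ} (hu : ∑ i, u i = 0)
    (f : EuclideanSpace ℝ (Fin m) → ℝ) : multiDeriv u f = f := by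
  -- The order `∑ i, u i` also occurs in the type of the argument tuple, so it is replaced by a
  -- variable before being set to zero.
  have key : ∀ (k : ℕ) (_ : k = 0) (x : EuclideanSpace ℝ (Fin m))
      (v : Fin k → EuclideanSpace ℝ (Fin m)), iteratedFDeriv ℝ k f x v = f x := by
    rintro k rfl x v
    simp
  funext x
  exact key _ hu x _

theorem holderNorm_le {m : ℕ} {β A B : ℝ} (hA : 0 ≤ A) (hB : 0 ≤ B)
    {Ω : Set (EuclideanSpace ℝ (Fin m))} {f : EuclideanSpace ℝ (Fin m) → ℝ}
    (h1 : ∀ u : Fin m → ℕ, ((∑ i, u i : ℕ) : ℝ) < β → ∀ x ∈ interior Ω, |multiDeriv u f x| ≤ A)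
    (h2 : ∀ u : Fin m → ℕ, ((∑ i, u i : ℕ) : ℝ) < β → β - 1 ≤ ((∑ i, u i : ℕ) : ℝ) →
      ∀ x ∈ interior Ω, ∀ z ∈ interior Ω,
        |multiDeriv u f x - multiDeriv u f z| ≤ B * ‖x - z‖ ^ (β + 1 - (⌈β⌉ : ℝ))) :
    holderNorm β Ω f ≤ ENNReal.ofReal (A + B) := by
  rw [ENNReal.ofReal_add hA hB]
  refine add_le_add ?_ ?_
  · exact iSup₂_le fun u hu => iSup₂_le fun x hx => ENNReal.ofReal_le_ofReal (h1 u hu x hx)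
  · refine iSup₂_le fun u hu => iSup₂_le fun x hx => iSup₂_le fun z hz => iSup_le fun hxz =>
      ENNReal.ofReal_le_ofReal ?_
    have : 0 < ‖x - z‖ := norm_pos_iff.2 (sub_ne_zero.2 hxz)
    rw [div_le_iff₀ (Real.rpow_pos_of_pos this _)]
    exact h2 u hu.1 hu.2 x hx z hz

theorem norm_iteratedFDeriv_sub_le {E F : Type*} [NormedAddCommGroup E] [NormedSpace ℝ E]
    [NormedAddCommGroup F] [NormedSpace ℝ F] {f : E → F}
    (hf : ContDiff ℝ (⊤ : ℕ∞) f) (k : ℕ) {C : ℝ}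
    (hC : ∀ x, ‖iteratedFDeriv ℝ (k + 1) f x‖ ≤ C) (x z : E) :
    ‖iteratedFDeriv ℝ k f x - iteratedFDeriv ℝ k f z‖ ≤ C * ‖x - z‖ := by
  refine Convex.norm_image_sub_le_of_norm_fderiv_le (𝕜 := ℝ) (s := Set.univ)
    (fun y _ => ?_) (fun y _ => ?_) convex_univ trivial trivial
  · exact (hf.differentiable_iteratedFDeriv (m := k) (by exact_mod_cast WithTop.coe_lt_top _)) y
  · rw [norm_fderiv_iteratedFDeriv]; exact hC y

/-- A bound on the next derivative makes each partial derivative Lipschitz. Only orders at least one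
are bounded, so that affine maps qualify. -/
theorem memC_of_contDiff {m : ℕ} (k : ℕ) (Ω : Set (EuclideanSpace ℝ (Fin m)))
    {f : EuclideanSpace ℝ (Fin m) → ℝ} (hf : ContDiff ℝ (⊤ : ℕ∞) f)
    (hb : ∀ l, ∃ C, ∀ x, ‖iteratedFDeriv ℝ (l + 1) f x‖ ≤ C) : MemC k Ω f := by
  refine ⟨hf.continuous.continuousOn, (hf.of_le (by exact_mod_cast le_top)).contDiffOn,
    fun u _ => ?_⟩
  obtain ⟨C, hC⟩ := hb (∑ i, u i)
  refine UniformContinuous.uniformContinuousOn ?_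
  have hL : LipschitzWith (Real.toNNReal C) (multiDeriv u f) := by
    refine LipschitzWith.of_dist_le' fun x z => ?_
    rw [Real.dist_eq, dist_eq_norm]
    exact (abs_multiDeriv_sub_le u f x z).trans (norm_iteratedFDeriv_sub_le hf _ hC x z)
  exact hL.uniformContinuous

theorem iteratedFDeriv_const_add {E : Type*} [NormedAddCommGroup E] [NormedSpace ℝ E]
    {f : E → ℝ} (hf : ContDiff ℝ (⊤ : ℕ∞) f) (a : ℝ) (k : ℕ) (x : E) :
    iteratedFDeriv ℝ k (fun y => a + f y) x =
      iteratedFDeriv ℝ k (fun _ : E => a) x + iteratedFDeriv ℝ k f x :=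
  iteratedFDeriv_add_apply contDiffAt_const (hf.of_le (by exact_mod_cast le_top)).contDiffAt

theorem iteratedFDeriv_const_eq {E : Type*} [NormedAddCommGroup E] [NormedSpace ℝ E]
    (a : ℝ) (k : ℕ) (x z : E) :
    iteratedFDeriv ℝ k (fun _ : E => a) x = iteratedFDeriv ℝ k (fun _ : E => a) z := by
  rcases eq_or_ne k 0 with rfl | hk
  · ext; simp
  · simp [iteratedFDeriv_const_of_ne hk]

theorem norm_iteratedFDeriv_const_le {E : Type*} [NormedAddCommGroup E] [NormedSpace ℝ E]
    (a : ℝ) (k : ℕ) (x : E) : ‖iteratedFDeriv ℝ k (fun _ : E => a) x‖ ≤ |a| := by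
  rcases eq_or_ne k 0 with rfl | hk
  · simp
  · simp [iteratedFDeriv_const_of_ne hk]

/-! ### Sums of bumps on the integer grid -/

/-- The centre of the unit cell with lower corner `j`. -/
noncomputable def cellCenter {m N : ℕ} (j : Fin m → Fin N) : EuclideanSpace ℝ (Fin m) :=
  WithLp.toLp 2 fun i => (j i : ℝ) + 1 / 2

/-- A smooth bump around the origin. -/
noncomputable def originBump (m : ℕ) : ContDiffBump (0 : EuclideanSpace ℝ (Fin m)) :=
  ⟨1 / 8, 1 / 4, by norm_num, by norm_num⟩

/-- The sum of the bumps in those unit cells `j` with `w j = true`. -/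
noncomputable def bumpSum {m N : ℕ} (w : (Fin m → Fin N) → Bool)
    (y : EuclideanSpace ℝ (Fin m)) : ℝ :=
  ∑ j, if w j then originBump m (y - cellCenter j) else 0

theorem one_le_norm_cellCenter_sub {m N : ℕ} {i j : Fin m → Fin N} (h : i ≠ j) :
    1 ≤ ‖cellCenter i - cellCenter j‖ := by
  obtain ⟨k, hk⟩ := Function.ne_iff.1 h
  refine le_trans ?_ (PiLp.norm_apply_le (cellCenter i - cellCenter j) k)
  have hk' : ((i k : ℕ) : ℤ) - ((j k : ℕ) : ℤ) ≠ 0 := by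
    intro h0; apply hk; ext; omega
  have h1 : (1 : ℝ) ≤ |((((i k : ℕ) : ℤ) - ((j k : ℕ) : ℤ) : ℤ) : ℝ)| := by
    exact_mod_cast Int.one_le_abs hk'
  simpa [cellCenter, Real.norm_eq_abs] using h1

/-- Centres are at distance at least `1`, so bumps of radius `1 / 4` have disjoint supports. -/
theorem eq_of_norm_sub_cellCenter_le {m N : ℕ} {i j : Fin m → Fin N}
    {y : EuclideanSpace ℝ (Fin m)} (hi : ‖y - cellCenter i‖ ≤ 1 / 4)
    (hj : ‖y - cellCenter j‖ ≤ 1 / 4) : i = j := by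
  by_contra h
  have h1 := one_le_norm_cellCenter_sub h
  have h2 : ‖cellCenter i - cellCenter j‖ ≤ ‖y - cellCenter i‖ + ‖y - cellCenter j‖ := by
    have : cellCenter i - cellCenter j = (y - cellCenter j) - (y - cellCenter i) := by abel
    rw [this]
    exact (norm_sub_le _ _).trans (by linarith)
  linarith

theorem originBump_eq_zero {m : ℕ} {y : EuclideanSpace ℝ (Fin m)} (hy : 1 / 4 ≤ ‖y‖) :
    originBump m y = 0 :=
  (originBump m).zero_of_le_dist (by simpa [originBump] using hy)

theorem originBump_eq_one {m : ℕ} {y : EuclideanSpace ℝ (Fin m)} (hy : ‖y‖ ≤ 1 / 8) :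
    originBump m y = 1 :=
  (originBump m).one_of_mem_closedBall (by simpa [originBump] using hy)

theorem contDiff_bumpSum {m N : ℕ} (w : (Fin m → Fin N) → Bool) :
    ContDiff ℝ (⊤ : ℕ∞) (bumpSum w) := by
  refine ContDiff.sum fun j _ => ?_
  split_ifs
  · exact (originBump m).contDiff.comp (contDiff_id.sub contDiff_const)
  · exact contDiff_const

theorem bumpSum_of_norm_le {m N : ℕ} (w : (Fin m → Fin N) → Bool) {j : Fin m → Fin N}
    {y : EuclideanSpace ℝ (Fin m)} (hy : ‖y - cellCenter j‖ ≤ 1 / 4) :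
    bumpSum w y = if w j then originBump m (y - cellCenter j) else 0 := by
  refine Finset.sum_eq_single j (fun i _ hij => ?_) (by simp)
  rw [originBump_eq_zero, ite_self]
  by_contra h
  exact hij (eq_of_norm_sub_cellCenter_le (not_le.1 h).le hy)

theorem bumpSum_mem_Icc {m N : ℕ} (w : (Fin m → Fin N) → Bool)
    (y : EuclideanSpace ℝ (Fin m)) : bumpSum w y ∈ Set.Icc (0 : ℝ) 1 := by
  by_cases h : ∃ j : Fin m → Fin N, ‖y - cellCenter j‖ ≤ 1 / 4
  · obtain ⟨j, hj⟩ := h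
    rw [bumpSum_of_norm_le w hj]
    split_ifs
    · exact ⟨(originBump m).nonneg, (originBump m).le_one⟩
    · simp
  · push Not at h
    have : bumpSum w y = 0 := Finset.sum_eq_zero fun j _ => by
      rw [originBump_eq_zero (h j).le, ite_self]
    simp [this]

theorem bumpSum_plateau {m N : ℕ} (w : (Fin m → Fin N) → Bool) {j : Fin m → Fin N}
    {y : EuclideanSpace ℝ (Fin m)} (hy : ‖y - cellCenter j‖ ≤ 1 / 8) :
    bumpSum w y = if w j then 1 else 0 := by
  rw [bumpSum_of_norm_le w (hy.trans (by norm_num)), originBump_eq_one hy]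

theorem bumpSum_update {m N : ℕ} (w : (Fin m → Fin N) → Bool) (j : Fin m → Fin N) (b : Bool)
    {y : EuclideanSpace ℝ (Fin m)} (hy : 1 / 4 ≤ ‖y - cellCenter j‖) :
    bumpSum (Function.update w j b) y = bumpSum w y := by
  refine Finset.sum_congr rfl fun i _ => ?_
  rcases eq_or_ne i j with rfl | h
  · rw [originBump_eq_zero hy, ite_self, ite_self]
  · rw [Function.update_of_ne h]

/-- The derivatives of sums of bumps are bounded uniformly in the number of cells and in the choice
of the bumps. -/
theorem exists_norm_iteratedFDeriv_bumpSum_le (m : ℕ) :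
    ∃ C : ℕ → ℝ, (∀ k, 0 ≤ C k) ∧ ∀ (k N : ℕ) (w : (Fin m → Fin N) → Bool)
      (y : EuclideanSpace ℝ (Fin m)), ‖iteratedFDeriv ℝ k (bumpSum w) y‖ ≤ C k := by
  have hcd : ContDiff ℝ (⊤ : ℕ∞) (originBump m) := (originBump m).contDiff
  have hC : ∀ k, ∃ C, ∀ y, ‖iteratedFDeriv ℝ k (originBump m) y‖ ≤ C := fun k =>
    (hcd.continuous_iteratedFDeriv (m := k)
      (by exact_mod_cast le_top)).bounded_above_of_compact_support
        ((originBump m).hasCompactSupport.iteratedFDeriv k)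
  choose C hC using hC
  refine ⟨C, fun k => (norm_nonneg _).trans (hC k 0), fun k N w y => ?_⟩
  have hCk := hC k
  have hterm : ∀ j, ContDiff ℝ k
      (fun y => if w j then originBump m (y - cellCenter j) else 0) := by
    intro j
    split_ifs
    · exact (hcd.of_le (by exact_mod_cast le_top)).comp (contDiff_id.sub contDiff_const)
    · exact contDiff_const
  have hsum : iteratedFDeriv ℝ k (bumpSum w) y = ∑ j, iteratedFDeriv ℝ k
      (fun y => if w j then originBump m (y - cellCenter j) else 0) y :=
    iteratedFDeriv_fun_sum_apply fun j _ => (hterm j).contDiffAt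
  have hval : ∀ j, iteratedFDeriv ℝ k
      (fun y => if w j then originBump m (y - cellCenter j) else 0) y =
        if w j then iteratedFDeriv ℝ k (originBump m) (y - cellCenter j) else 0 := by
    intro j
    split_ifs
    · exact iteratedFDeriv_comp_sub k (cellCenter j) y
    · simp
  have hzero : ∀ z, 1 / 4 < ‖z‖ → iteratedFDeriv ℝ k (originBump m) z = 0 := by
    intro z hz
    by_contra h
    have hmem := support_iteratedFDeriv_subset (𝕜 := ℝ) k (Function.mem_support.2 h)
    rw [(originBump m).tsupport_eq] at hmem
    simp only [originBump, Metric.mem_closedBall, dist_zero_right] at hmem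
    linarith
  rw [hsum]
  simp_rw [hval]
  by_cases h : ∃ j : Fin m → Fin N, ‖y - cellCenter j‖ ≤ 1 / 4
  · obtain ⟨j, hj⟩ := h
    rw [Finset.sum_eq_single j (fun i _ hij => ?_) (by simp)]
    · split_ifs
      · exact hCk _
      · simpa using (norm_nonneg _).trans (hCk 0)
    · rw [hzero, ite_self]
      by_contra h
      exact hij (eq_of_norm_sub_cellCenter_le (not_lt.1 h) hj)
  · push Not at h
    rw [Finset.sum_eq_zero fun j _ => by rw [hzero _ (h j), ite_self], norm_zero]
    exact (norm_nonneg _).trans (hCk 0)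

/-- Interpolates between the trivial bound and the Lipschitz bound on an increment, to produce a
Hölder bound. -/
theorem min_two_le_two_mul_rpow {t s : ℝ} (ht : 0 ≤ t) (hs0 : 0 ≤ s) (hs1 : s ≤ 1) :
    min 2 t ≤ 2 * t ^ s := by
  rcases le_total t 1 with h | h
  · refine (min_le_right _ _).trans ?_
    rcases ht.eq_or_lt with rfl | h0
    · positivity
    · have : t ^ (1 : ℝ) ≤ t ^ s := Real.rpow_le_rpow_of_exponent_ge h0 h hs1
      rw [Real.rpow_one] at this
      linarith
  · refine (min_le_left _ _).trans ?_
    have := Real.one_le_rpow h hs0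
    linarith

/-- Rescaled sums of bumps of height of order `N ^ (-β)` on a grid of mesh `1 / N` lie in a
Hölder-`β` ball. -/
theorem exists_scaled_bumpSum_mem_holderBall (m : ℕ) (β : ℝ) {ρ : ℝ} (hρ : 0 < ρ) :
    ∃ ε : ℝ, 0 < ε ∧ ε ≤ 1 / 4 ∧ ∀ (N : ℕ), 1 ≤ N → ∀ (w : (Fin m → Fin N) → Bool) (a r : ℝ),
      0 ≤ a → a + ρ ≤ r →
        (fun y => a + ε * (N : ℝ) ^ (-β) * bumpSum w ((N : ℝ) • y)) ∈
          HolderBall β r (unitCube m) := by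
  obtain ⟨C, hC0, hC⟩ := exists_norm_iteratedFDeriv_bumpSum_le m
  set D : ℝ := 1 + ∑ k ∈ Finset.range (⌈β⌉₊ + 1), C k
  have hCD : ∀ k ≤ ⌈β⌉₊, C k ≤ D := by
    intro k hk
    have : C k ≤ ∑ k ∈ Finset.range (⌈β⌉₊ + 1), C k :=
      Finset.single_le_sum (fun i _ => hC0 i) (Finset.mem_range.2 (by omega))
    simp only [D]; linarith
  have hD : 1 ≤ D := by
    have : 0 ≤ ∑ k ∈ Finset.range (⌈β⌉₊ + 1), C k := Finset.sum_nonneg fun i _ => hC0 i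
    simp only [D]; linarith
  have hD0 : 0 < D := by linarith
  -- The sup norms will cost `a + ε D` and the Hölder quotients `2 ε D`; hence the factor `3`.
  set ε := min (1 / 4) (ρ / (3 * D))
  have hε0 : 0 < ε := lt_min (by norm_num) (by positivity)
  refine ⟨ε, hε0, min_le_left _ _, fun N hN w a r ha har => ?_⟩
  have hεD : 3 * (ε * D) ≤ ρ := by
    have : ε ≤ ρ / (3 * D) := min_le_right _ _
    rw [le_div_iff₀ (by positivity)] at this
    linarith
  have hN1 : (1 : ℝ) ≤ N := by exact_mod_cast hN
  have hN0 : (0 : ℝ) < N := by linarith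
  set v := ε * (N : ℝ) ^ (-β)
  have hv : 0 < v := by positivity
  set G : EuclideanSpace ℝ (Fin m) → ℝ := fun y => v * bumpSum w ((N : ℝ) • y)
  have hcd1 : ContDiff ℝ (⊤ : ℕ∞) fun y : EuclideanSpace ℝ (Fin m) => bumpSum w ((N : ℝ) • y) :=
    (contDiff_bumpSum w).comp (contDiff_const_smul _)
  have hG : ContDiff ℝ (⊤ : ℕ∞) G := contDiff_const.mul hcd1
  have hGk : ∀ k x, ‖iteratedFDeriv ℝ k G x‖ ≤ v * (N : ℝ) ^ k * C k := by
    intro k x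
    have h1 : iteratedFDeriv ℝ k G x =
        v • iteratedFDeriv ℝ k (fun y => bumpSum w ((N : ℝ) • y)) x :=
      iteratedFDeriv_const_smul_apply' (a := v)
        (hcd1.of_le (by exact_mod_cast le_top)).contDiffAt
    rw [h1, iteratedFDeriv_comp_const_smul _
      ((contDiff_bumpSum w).of_le (by exact_mod_cast le_top)), norm_smul, norm_smul,
      Real.norm_of_nonneg hv.le, Real.norm_of_nonneg (by positivity), ← mul_assoc]
    gcongr
    exact hC k N w _
  have hadd := iteratedFDeriv_const_add hG a
  refine ⟨memC_of_contDiff _ _ (contDiff_const.add hG) fun l =>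
    ⟨|a| + v * (N : ℝ) ^ (l + 1) * C (l + 1), fun x => ?_⟩, ?_⟩
  · refine (congrArg norm (hadd (l + 1) x)).trans_le ?_
    exact (norm_add_le _ _).trans
      (add_le_add (norm_iteratedFDeriv_const_le a _ x) (hGk _ x))
  have hsub : ∀ k x z, iteratedFDeriv ℝ k (fun y => a + G y) x -
      iteratedFDeriv ℝ k (fun y => a + G y) z =
        iteratedFDeriv ℝ k G x - iteratedFDeriv ℝ k G z := by
    intro k x z
    rw [hadd, hadd, iteratedFDeriv_const_eq a k x z]
    abel
  refine (holderNorm_le (A := a + ε * D) (B := 2 * (ε * D)) (by positivity) (by positivity)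
    (fun u hu x _ => ?_) (fun u hu hu' x _ z _ => ?_)).trans
      (ENNReal.ofReal_le_ofReal (by linarith))
  · refine (abs_multiDeriv_le u _ x).trans ((congrArg norm (hadd _ x)).trans_le ?_)
    refine (norm_add_le _ _).trans (add_le_add
      ((norm_iteratedFDeriv_const_le a _ x).trans_eq (abs_of_nonneg ha)) ((hGk _ x).trans ?_))
    set k := ∑ i, u i
    have hk : k ≤ ⌈β⌉₊ := (Nat.lt_ceil.2 hu).le
    have h1 : v * (N : ℝ) ^ k ≤ ε := by
      have : (N : ℝ) ^ (-β) * (N : ℝ) ^ k ≤ 1 := by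
        rw [← Real.rpow_natCast, ← Real.rpow_add hN0]
        exact Real.rpow_le_one_of_one_le_of_nonpos hN1 (by linarith)
      simp only [v]
      rw [mul_assoc]
      exact mul_le_of_le_one_right hε0.le this
    exact mul_le_mul h1 (hCD k hk) (hC0 k) hε0.le
  · refine (abs_multiDeriv_sub_le u _ x z).trans ?_
    refine (congrArg norm (hsub _ x z)).trans_le ?_
    set k := ∑ i, u i
    have hk : k < ⌈β⌉₊ := Nat.lt_ceil.2 hu
    -- The conditions `β - 1 ≤ k < β` leave one order only, and the Hölder exponent becomes `β - k`.
    have hceil : ⌈β⌉ = (k : ℤ) + 1 := by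
      rw [Int.ceil_eq_iff]
      push_cast
      constructor <;> linarith
    have hs : β + 1 - (⌈β⌉ : ℝ) = β - k := by rw [hceil]; push_cast; ring
    rw [hs]
    set s := β - k
    have hs0 : 0 ≤ s := by simp only [s]; linarith
    have hs1 : s ≤ 1 := by simp only [s]; linarith
    -- This power of `N` cancels the `N ^ s` that rescaling contributes to the Hölder quotient, so
    -- the final bound is free of `N`.
    have hvk : v * (N : ℝ) ^ k = ε * (N : ℝ) ^ (-s) := by
      simp only [v, s]
      rw [mul_assoc, ← Real.rpow_natCast, ← Real.rpow_add hN0]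
      congr 2; ring
    have b1 : ‖iteratedFDeriv ℝ k G x - iteratedFDeriv ℝ k G z‖ ≤
        v * (N : ℝ) ^ k * D * (N * ‖x - z‖) := by
      refine (norm_iteratedFDeriv_sub_le hG k (hGk (k + 1)) x z).trans ?_
      calc v * (N : ℝ) ^ (k + 1) * C (k + 1) * ‖x - z‖
          ≤ v * (N : ℝ) ^ (k + 1) * D * ‖x - z‖ := by gcongr; exact hCD _ hk
        _ = _ := by ring
    have b2 : ‖iteratedFDeriv ℝ k G x - iteratedFDeriv ℝ k G z‖ ≤
        v * (N : ℝ) ^ k * D * 2 := by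
      have hx : ∀ y, ‖iteratedFDeriv ℝ k G y‖ ≤ v * (N : ℝ) ^ k * D := fun y =>
        (hGk k y).trans (by gcongr; exact hCD _ hk.le)
      refine (norm_sub_le _ _).trans ?_
      linarith [hx x, hx z]
    have b3 : ‖iteratedFDeriv ℝ k G x - iteratedFDeriv ℝ k G z‖ ≤
        v * (N : ℝ) ^ k * D * min 2 (N * ‖x - z‖) := by
      rcases min_choice 2 (N * ‖x - z‖) with h | h <;> rw [h] <;> assumption
    refine b3.trans ?_
    calc v * (N : ℝ) ^ k * D * min 2 (N * ‖x - z‖)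
        ≤ v * (N : ℝ) ^ k * D * (2 * (N * ‖x - z‖) ^ s) := by
          gcongr
          exact min_two_le_two_mul_rpow (by positivity) hs0 hs1
      _ = 2 * (ε * D) * ‖x - z‖ ^ s * ((N : ℝ) ^ (-s) * (N : ℝ) ^ s) := by
          rw [hvk, Real.mul_rpow hN0.le (norm_nonneg _)]; ring
      _ = 2 * (ε * D) * ‖x - z‖ ^ s := by
          rw [← Real.rpow_add hN0]; simp

/-! ### Power maps of one coordinate -/

theorem abs_rpow_sub_rpow_le {s t γ : ℝ} (hs : 0 ≤ s) (ht : 0 ≤ t) (hγ0 : 0 < γ)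
    (hγ1 : γ ≤ 1) : |s ^ γ - t ^ γ| ≤ |s - t| ^ γ := by
  wlog h : t ≤ s generalizing s t
  · rw [abs_sub_comm, abs_sub_comm s]
    exact this ht hs (le_of_not_ge h)
  have h1 : t ^ γ ≤ s ^ γ := Real.rpow_le_rpow ht h hγ0.le
  rw [abs_of_nonneg (by linarith), abs_of_nonneg (by linarith)]
  have := Real.rpow_add_le_add_rpow ht (sub_nonneg.2 h) hγ0.le hγ1
  rw [add_sub_cancel] at this
  linarith

/-- As `β > 1`, the Hölder quotients involve only derivatives of order at least one. These are
constant, so only the sup norms count. -/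
theorem coord_affine_mem_holderBall {m : ℕ} (i : Fin m) {β r a c : ℝ} (hβ : 1 < β) (ha : 0 ≤ a)
    (hc : 0 ≤ c) (har : a + c ≤ r) :
    (fun y : EuclideanSpace ℝ (Fin m) => a + c * y i) ∈ HolderBall β r (unitCube m) := by
  set L : EuclideanSpace ℝ (Fin m) →L[ℝ] ℝ := c • EuclideanSpace.proj i
  have hL : (fun y : EuclideanSpace ℝ (Fin m) => a + c * y i) = fun y => a + L y := by
    funext y; simp [L]
  have hLn : ‖L‖ ≤ c := by
    refine L.opNorm_le_bound hc fun y => ?_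
    simp only [L, FunLike.coe_smul, Pi.smul_apply, EuclideanSpace.coe_proj, norm_smul,
      Real.norm_of_nonneg hc]
    gcongr
    exact PiLp.norm_apply_le y i
  have hcd : ContDiff ℝ (⊤ : ℕ∞) L := L.contDiff
  have hfd : fderiv ℝ (fun y => a + L y) = fun _ => L := by
    funext y
    rw [fderiv_const_add, L.fderiv]
  have hnorm : ∀ k x, ‖iteratedFDeriv ℝ (k + 1) (fun y => a + L y) x‖ ≤ c := by
    intro k x
    rw [← norm_iteratedFDeriv_fderiv, hfd]
    rcases eq_or_ne k 0 with rfl | hk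
    · simpa using hLn
    · simpa [iteratedFDeriv_const_of_ne hk] using hc
  have hzero : ∀ k x, ‖iteratedFDeriv ℝ (k + 2) (fun y => a + L y) x‖ ≤ 0 := by
    intro k x
    rw [← norm_iteratedFDeriv_fderiv, hfd, iteratedFDeriv_const_of_ne (by omega)]
    simp
  have hsm : ContDiff ℝ (⊤ : ℕ∞) fun y => a + L y := contDiff_const.add hcd
  rw [hL]
  refine ⟨memC_of_contDiff _ _ hsm fun l => ⟨c, hnorm l⟩, ?_⟩
  refine (holderNorm_le (A := a + c) (B := 0) (by positivity) le_rfl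
    (fun u hu x hx => ?_) (fun u hu hu' x _ z _ => ?_)).trans
      (ENNReal.ofReal_le_ofReal (by linarith))
  · rcases Nat.eq_zero_or_pos (∑ i, u i) with h | h
    · rw [multiDeriv_of_sum_eq_zero h, ← congrFun hL x]
      have := interior_subset hx i
      have h0 : 0 ≤ c * x i := mul_nonneg hc this.1
      have h1 : c * x i ≤ c := mul_le_of_le_one_right hc this.2
      dsimp only
      rw [abs_of_nonneg (by linarith)]
      linarith
    · refine (abs_multiDeriv_le u _ x).trans ?_
      obtain ⟨k, hk⟩ : ∃ k, ∑ i, u i = k + 1 := ⟨_, (Nat.succ_pred_eq_of_pos h).symm⟩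
      rw [hk]
      linarith [hnorm k x]
  · refine (abs_multiDeriv_sub_le u _ x z).trans ?_
    obtain ⟨k, hk⟩ : ∃ k, ∑ i, u i = k + 1 := by
      refine ⟨_, (Nat.succ_pred_eq_of_pos (Nat.pos_of_ne_zero fun h => ?_)).symm⟩
      rw [h] at hu'
      push_cast at hu'
      linarith
    rw [hk]
    simpa using norm_iteratedFDeriv_sub_le hsm (k + 1) (hzero k) x z

/-- For `β ≤ 1` only the function itself enters the norm, and subadditivity of `t ↦ t ^ β` bounds
its Hölder quotient by `c`. For `β > 1` the map is affine. -/
theorem coord_rpow_mem_holderBall {m : ℕ} (i : Fin m) {β r a c : ℝ} (hβ : 0 < β) (ha : 0 ≤ a)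
    (hc : 0 ≤ c) (har : a + 2 * c ≤ r) :
    (fun y : EuclideanSpace ℝ (Fin m) => a + c * (y i) ^ (min 1 β)) ∈
      HolderBall β r (unitCube m) := by
  rcases lt_or_ge 1 β with h1 | h1
  · simpa only [min_eq_left h1.le, Real.rpow_one] using
      coord_affine_mem_holderBall i h1 ha hc (by linarith)
  rw [min_eq_right h1]
  set f := fun y : EuclideanSpace ℝ (Fin m) => a + c * (y i) ^ β
  have hcont : Continuous f := by
    have : Continuous fun t : ℝ => t ^ β := Real.continuous_rpow_const hβ.le
    fun_prop
  have hk : ⌈β - 1⌉₊ = 0 := Nat.ceil_eq_zero.2 (by linarith)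
  have hceil : ⌈β⌉ = 1 := by
    rw [Int.ceil_eq_iff]; push_cast; constructor <;> linarith
  have hexp : β + 1 - (⌈β⌉ : ℝ) = β := by rw [hceil]; push_cast; ring
  have hcompact : IsCompact (unitCube m) := by
    have h := (isCompact_univ_pi fun _ : Fin m => isCompact_Icc (a := (0 : ℝ)) (b := 1)).image
      (PiLp.continuous_toLp 2 fun _ : Fin m => ℝ)
    convert h using 1
    ext x
    constructor
    · intro hx
      exact ⟨WithLp.ofLp x, fun i _ => hx i, rfl⟩
    · rintro ⟨y, hy, rfl⟩ i
      exact hy i trivial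
  refine ⟨⟨hcont.continuousOn, ?_, fun u hu => ?_⟩, ?_⟩
  · rw [hk]
    exact contDiffOn_zero.2 hcont.continuousOn
  · rw [multiDeriv_of_sum_eq_zero (by omega)]
    exact (hcompact.uniformContinuousOn_of_continuous hcont.continuousOn).mono interior_subset
  · have hu0 : ∀ u : Fin m → ℕ, ((∑ i, u i : ℕ) : ℝ) < β → ∑ i, u i = 0 := by
      intro u hu
      have : ((∑ i, u i : ℕ) : ℝ) < 1 := by linarith
      exact_mod_cast Nat.lt_one_iff.1 (by exact_mod_cast this)
    refine (holderNorm_le (A := a + c) (B := c) (by positivity) hc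
      (fun u hu x hx => ?_) (fun u hu hu' x hx z hz => ?_)).trans
        (ENNReal.ofReal_le_ofReal (by linarith))
    · rw [multiDeriv_of_sum_eq_zero (hu0 u hu)]
      have hx' := interior_subset hx i
      have h2 : 0 ≤ (x i) ^ β := Real.rpow_nonneg hx'.1 _
      have h3 : (x i) ^ β ≤ 1 := Real.rpow_le_one hx'.1 hx'.2 hβ.le
      simp only [f]
      rw [abs_of_nonneg (by positivity)]
      nlinarith
    · rw [multiDeriv_of_sum_eq_zero (hu0 u hu), hexp]
      have hx' := interior_subset hx i
      have hz' := interior_subset hz i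
      have : f x - f z = c * ((x i) ^ β - (z i) ^ β) := by simp only [f]; ring
      rw [this, abs_mul, abs_of_nonneg hc]
      gcongr
      refine (abs_rpow_sub_rpow_le hx'.1 hz'.1 hβ h1).trans ?_
      gcongr
      simpa using PiLp.norm_apply_le (x - z) i

/-! ### Boxes in the cube -/

/-- The points of the cube whose coordinates along `e`, rescaled by `N`, are within `t` of the
centre of the unit cell `j`. -/
def cellBox {d m N : ℕ} (e : Fin m ↪ Fin d) (j : Fin m → Fin N) (t : ℝ) : Set (Cube d) :=
  {x | ∀ i, |(N : ℝ) * x (e i) - ((j i : ℝ) + 1 / 2)| ≤ t}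

theorem measurableSet_cellBox {d m N : ℕ} (e : Fin m ↪ Fin d) (j : Fin m → Fin N) (t : ℝ) :
    MeasurableSet (cellBox e j t) := by
  have : cellBox e j t = ⋂ i, {x | |(N : ℝ) * x (e i) - ((j i : ℝ) + 1 / 2)| ≤ t} := by
    ext x; simp [cellBox]
  rw [this]
  exact MeasurableSet.iInter fun i => measurableSet_le (by fun_prop) measurable_const

theorem volume_slab {N : ℕ} (j : Fin N) {t : ℝ} (ht0 : 0 ≤ t) (ht : t ≤ 1 / 2) :
    volume {u : unitInterval | |(N : ℝ) * u - ((j : ℝ) + 1 / 2)| ≤ t} =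
      ENNReal.ofReal (2 * t / N) := by
  have hj : ((j : ℕ) : ℝ) + 1 ≤ N := by exact_mod_cast j.2
  have hj0 : (0 : ℝ) ≤ (j : ℕ) := Nat.cast_nonneg _
  have hN : (0 : ℝ) < N := by linarith
  have ha : ((j : ℝ) + 1 / 2 - t) / N ∈ Set.Icc (0 : ℝ) 1 :=
    ⟨by apply div_nonneg <;> linarith, by rw [div_le_one hN]; linarith⟩
  have hb : ((j : ℝ) + 1 / 2 + t) / N ∈ Set.Icc (0 : ℝ) 1 :=
    ⟨by positivity, by rw [div_le_one hN]; linarith⟩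
  have hset : {u : unitInterval | |(N : ℝ) * u - ((j : ℝ) + 1 / 2)| ≤ t} =
      Set.Icc ⟨_, ha⟩ ⟨_, hb⟩ := by
    ext u
    rw [Set.mem_ofPred_eq, Set.mem_Icc, ← Subtype.coe_le_coe, ← Subtype.coe_le_coe, abs_le,
      div_le_iff₀ hN, le_div_iff₀ hN]
    constructor <;> rintro ⟨h1, h2⟩ <;> constructor <;> linarith
  rw [hset, unitInterval.volume_Icc]
  congr 1
  field_simp
  ring

theorem volume_cellBox {d m N : ℕ} (e : Fin m ↪ Fin d) (j : Fin m → Fin N) {t : ℝ}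
    (ht0 : 0 ≤ t) (ht : t ≤ 1 / 2) :
    volume (cellBox e j t) = ENNReal.ofReal ((2 * t / N) ^ m) := by
  set A : Fin d → Set unitInterval := fun k =>
    {u | ∀ i, e i = k → |(N : ℝ) * u - ((j i : ℝ) + 1 / 2)| ≤ t}
  have hbox : cellBox e j t = ((Finset.univ.map e : Finset (Fin d)) : Set (Fin d)).pi A := by
    ext x
    simp only [cellBox, A, Set.mem_ofPred_eq, Set.mem_pi, Finset.coe_map, Finset.coe_univ,
      Set.image_univ, Set.mem_range]
    constructor
    · rintro h k - i rfl
      exact h i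
    · intro h i
      exact h (e i) ⟨i, rfl⟩ i rfl
  have hA : ∀ i, A (e i) = {u : unitInterval | |(N : ℝ) * u - ((j i : ℝ) + 1 / 2)| ≤ t} := by
    intro i
    ext u
    simp only [A, Set.mem_ofPred_eq]
    constructor
    · intro h; exact h i rfl
    · intro h i' hi'
      rw [e.injective hi']; exact h
  rw [hbox, volume_pi, Measure.pi_pi_finset, Finset.prod_map]
  simp_rw [hA, volume_slab _ ht0 ht]
  rw [Finset.prod_const, Finset.card_univ, Fintype.card_fin,
    ENNReal.ofReal_pow (by positivity)]

/-- The coordinates along `e`, as a point of Euclidean space. -/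
noncomputable def coords {d m : ℕ} (e : Fin m ↪ Fin d) (x : Cube d) :
    EuclideanSpace ℝ (Fin m) :=
  WithLp.toLp 2 fun i => (x (e i) : ℝ)

theorem continuous_coords {d m : ℕ} (e : Fin m ↪ Fin d) : Continuous (coords e) := by
  unfold coords
  fun_prop

/-- A cube of half-side `1 / (8 m)` fits into the ball of radius `1 / 8` because `√m ≤ m`. Boxes
replace balls so that volumes are explicit. -/
theorem norm_sub_cellCenter_le {d m N : ℕ} {e : Fin m ↪ Fin d} {j : Fin m → Fin N} {x : Cube d}
    (hm : 1 ≤ m) (hx : x ∈ cellBox e j (1 / (8 * m))) :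
    ‖(N : ℝ) • coords e x - cellCenter j‖ ≤ 1 / 8 := by
  have hm' : (1 : ℝ) ≤ m := by exact_mod_cast hm
  refine abs_le_of_sq_le_sq' ?_ (by norm_num) |>.2
  rw [EuclideanSpace.norm_sq_eq]
  calc ∑ i, ‖((N : ℝ) • coords e x - cellCenter j) i‖ ^ 2
      ≤ ∑ _i : Fin m, (1 / (8 * (m : ℝ))) ^ 2 := by
        gcongr with i _
        have := hx i
        simpa [coords, cellCenter, Real.norm_eq_abs] using this
    _ = (1 / 8) ^ 2 * (1 / m) := by
        rw [Finset.sum_const, Finset.card_univ, Fintype.card_fin, nsmul_eq_mul]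
        field_simp
    _ ≤ (1 / 8) ^ 2 * 1 := by
        gcongr
        rw [div_le_one (by linarith)]; exact hm'
    _ = (1 / 8) ^ 2 := mul_one _

theorem le_norm_sub_cellCenter {d m N : ℕ} {e : Fin m ↪ Fin d} {j : Fin m → Fin N} {x : Cube d}
    {t : ℝ} (hx : x ∉ cellBox e j t) : t ≤ ‖(N : ℝ) • coords e x - cellCenter j‖ := by
  simp only [cellBox, Set.mem_ofPred_eq, not_forall, not_le] at hx
  obtain ⟨i, hi⟩ := hx
  refine hi.le.trans (le_trans (le_of_eq ?_)
    (PiLp.norm_apply_le ((N : ℝ) • coords e x - cellCenter j) i))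
  simp [coords, cellCenter, Real.norm_eq_abs]

/-! ### Iterated power maps -/

/-- The map `t ↦ c t ^ γ`. -/
noncomputable def powerMap (c γ t : ℝ) : ℝ := c * t ^ γ

theorem powerMap_iterate_mono {c γ : ℝ} (hc : 0 ≤ c) (hγ : 0 ≤ γ) (q : ℕ) {s t : ℝ}
    (hs : 0 ≤ s) (hst : s ≤ t) :
    0 ≤ (powerMap c γ)^[q] s ∧ (powerMap c γ)^[q] s ≤ (powerMap c γ)^[q] t := by
  induction q with
  | zero => exact ⟨hs, hst⟩
  | succ q ih =>
    obtain ⟨h1, h2⟩ := ih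
    rw [Function.iterate_succ_apply', Function.iterate_succ_apply']
    unfold powerMap at h1 h2 ⊢
    exact ⟨by positivity, by gcongr⟩

theorem powerMap_iterate_zero {c γ : ℝ} (hγ : γ ≠ 0) (q : ℕ) : (powerMap c γ)^[q] 0 = 0 :=
  Function.iterate_fixed (by simp [powerMap, Real.zero_rpow hγ]) q

theorem powerMap_mem_Icc {c γ t : ℝ} (hc0 : 0 ≤ c) (hc1 : c ≤ 1) (hγ : 0 ≤ γ)
    (ht : t ∈ Set.Icc (0 : ℝ) 1) : powerMap c γ t ∈ Set.Icc (0 : ℝ) 1 :=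
  ⟨mul_nonneg hc0 (Real.rpow_nonneg ht.1 _),
    mul_le_one₀ hc1 (Real.rpow_nonneg ht.1 _) (Real.rpow_le_one ht.1 ht.2 hγ)⟩

theorem continuous_powerMap_iterate {c γ : ℝ} (hγ : 0 ≤ γ) (q : ℕ) :
    Continuous (powerMap c γ)^[q] :=
  Continuous.iterate (continuous_const.mul (Real.continuous_rpow_const hγ)) q

/-- Each step multiplies the exponent of `N` by `γ` and replaces `C` by `c * C ^ γ`, which does not
involve `N`. -/
theorem exists_powerMap_iterate_eq {c γ ε β : ℝ} (hc0 : 0 < c) (hc : c ≤ 1 / 4) (hγ : 0 ≤ γ)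
    (hε0 : 0 < ε) (hε : ε ≤ 1 / 4) (q : ℕ) :
    ∃ C : ℝ, 0 < C ∧ C ≤ 1 / 4 ∧ ∀ N : ℝ, 0 < N →
      (powerMap c γ)^[q] (ε * N ^ (-β)) = C * N ^ (-(β * γ ^ q)) := by
  induction q with
  | zero => exact ⟨ε, hε0, hε, fun N _ => by simp⟩
  | succ q ih =>
    obtain ⟨C, hC0, hC1, hC⟩ := ih
    refine ⟨c * C ^ γ, by positivity, ?_, fun N hN => ?_⟩
    · have : C ^ γ ≤ 1 := Real.rpow_le_one hC0.le (by linarith) hγ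
      nlinarith
    · rw [Function.iterate_succ_apply', hC N hN, powerMap,
        Real.mul_rpow hC0.le (Real.rpow_nonneg hN.le _), ← Real.rpow_mul hN.le, ← mul_assoc]
      congr 2
      ring

/-! ### Compositional regression functions -/

theorem exists_embedding_GH {d m : ℕ} (hmd : m ≤ d) :
    ∃ e : Fin m ↪ Fin d, ∀ (β r : ℝ), ∀ g ∈ HolderBall β r (unitCube m),
      (fun x => g (coords e x)) ∈ GH d m β r := by
  obtain ⟨I, -, hI⟩ := Finset.exists_subset_card_eq (s := (Finset.univ : Finset (Fin d)))
    (n := m) (by simpa using hmd)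
  exact ⟨(I.orderEmbOfFin hI).toEmbedding, fun β r g hg => ⟨I, hI, g, hg, fun x => rfl⟩⟩

/-- All components of every layer are copies of one function, so it does not matter which
coordinates the next layer reads; it uses one of its `m` and ignores the others. -/
theorem exists_mem_innerComp {d K m : ℕ} (hm : 1 ≤ m) (hmK : m ≤ K) {β r c : ℝ} (hβ : 0 < β)
    (hc0 : 0 ≤ c) (hc1 : c ≤ 1) (hcr : 2 * c ≤ r) {f : Cube d → ℝ}
    (hf : f ∈ GH d m β r) (hf01 : ∀ x, f x ∈ Set.Icc (0 : ℝ) 1) (q : ℕ) :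
    ∃ p ∈ innerComp d K m β r q, ∀ x j, (p x j : ℝ) = (powerMap c (min 1 β))^[q] (f x) := by
  have hγ : 0 ≤ min 1 β := le_min zero_le_one hβ.le
  obtain ⟨e, he⟩ := exists_embedding_GH hmK
  induction q with
  | zero => exact ⟨fun x _ => ⟨f x, hf01 x⟩, fun _ => hf, fun _ _ => rfl⟩
  | succ q ih =>
    obtain ⟨p, hp, hpx⟩ := ih
    set h : Cube K → Cube K := fun x _ =>
      ⟨powerMap c (min 1 β) (x (e ⟨0, hm⟩)), powerMap_mem_Icc hc0 hc1 hγ (x (e ⟨0, hm⟩)).2⟩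
    have hh : h ∈ GHVec K K m β r := by
      intro j
      have := he β r _ (coord_rpow_mem_holderBall (⟨0, hm⟩ : Fin m) hβ le_rfl hc0
        (by linarith : 0 + 2 * c ≤ r))
      simp only [zero_add] at this
      exact this
    refine ⟨h ∘ p, ⟨h, hh, p, hp, rfl⟩, fun x j => ?_⟩
    rw [Function.iterate_succ_apply', ← hpx x (e ⟨0, hm⟩)]
    rfl

/-- The constant is absorbed by the outermost layer: for `q = 0` that is the bump function itself,
hence `hfa`; otherwise it is the last power map. The form of `hmK` demands `m ≤ K` only when layers
on `[0,1]^K` exist. -/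
theorem const_add_powerMap_iterate_mem_GCH {d K m q : ℕ} (hm : 1 ≤ m) (hmK : m * q ≤ K * q)
    {β r c a : ℝ} (hβ : 0 < β) (hc0 : 0 ≤ c) (hc1 : c ≤ 1) (ha : 0 ≤ a) (hcr : a + 2 * c ≤ r)
    {f : Cube d → ℝ} (hf : f ∈ GH d m β r) (hfa : (fun x => a + f x) ∈ GH d m β r)
    (hf01 : ∀ x, f x ∈ Set.Icc (0 : ℝ) 1) :
    (fun x => a + (powerMap c (min 1 β))^[q] (f x)) ∈ GCH d q K m β r := by
  cases q with
  | zero => exact hfa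
  | succ q =>
    have hmK' : m ≤ K := Nat.le_of_mul_le_mul_right hmK (Nat.succ_pos q)
    obtain ⟨e, he⟩ := exists_embedding_GH hmK'
    obtain ⟨p, hp, hpx⟩ := exists_mem_innerComp hm hmK' hβ hc0 hc1 (by linarith) hf hf01 q
    refine ⟨_, he β r _ (coord_rpow_mem_holderBall (⟨0, hm⟩ : Fin m) hβ ha hc0 hcr), p, hp, ?_⟩
    funext x
    rw [Function.iterate_succ_apply', ← hpx x (e ⟨0, hm⟩)]
    rfl

theorem volume_mem_boundedDensity (d : ℕ) {Λ : ℝ} (hΛ : 1 ≤ Λ) :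
    (volume : Measure (Cube d)) ∈ BoundedDensity d Λ :=
  ⟨inferInstance, fun _ => 1, measurable_const, fun _ => ⟨zero_le_one, hΛ⟩, by simp⟩

/-- The lower bound for a fixed resolution `N` of the grid. -/
theorem exists_le_minimaxRisk_of_resolution (q m : ℕ) (hm : 1 ≤ m) {β r : ℝ} (hβ : 0 < β)
    (hr : 1 / 2 < r) :
    ∃ C : ℝ, 0 < C ∧ ∀ (d K : ℕ) (Λ : ℝ), 1 ≤ Λ → m * q ≤ K * q → m ≤ d → ∀ n N : ℕ, 1 ≤ N →
      (n : ℝ) ≤ (N : ℝ) ^ ((m : ℝ) + 2 * (β * (min 1 β) ^ q)) →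
        ENNReal.ofReal (C * (N : ℝ) ^ (-(β * (min 1 β) ^ q))) ≤
          minimaxRisk n (Model d q K m β r Λ) := by
  set γ := min 1 β
  have hγ : 0 < γ := lt_min zero_lt_one hβ
  set B := β * γ ^ q
  set c := min (1 / 4) ((r - 1 / 2) / 2)
  have hc0 : 0 < c := lt_min (by norm_num) (by linarith)
  have hc4 : c ≤ 1 / 4 := min_le_left _ _
  have hcr : 1 / 2 + 2 * c ≤ r := by
    have : c ≤ (r - 1 / 2) / 2 := min_le_right _ _
    linarith
  obtain ⟨ε, hε0, hε4, hball⟩ :=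
    exists_scaled_bumpSum_mem_holderBall m β (sub_pos.2 hr)
  obtain ⟨C, hC0, hC4, hC⟩ := exists_powerMap_iterate_eq (β := β) hc0 hc4 hγ.le hε0 hε4 q
  have hm' : (1 : ℝ) ≤ m := by exact_mod_cast hm
  -- There are `N ^ m` plateaus of volume `(1 / (4 m N)) ^ m`, and the cell bound has the factor `δ
  -- / 2 = C N ^ (-B) / 4`.
  refine ⟨(1 / (4 * (m : ℝ))) ^ m * C / 4, by positivity, ?_⟩
  intro d K Λ hΛ hmK hmd n N hN hnN
  obtain ⟨e, he⟩ := exists_embedding_GH hmd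
  have hN1 : (1 : ℝ) ≤ N := by exact_mod_cast hN
  have hN0 : (0 : ℝ) < N := by linarith
  set v := ε * (N : ℝ) ^ (-β)
  have hv0 : 0 < v := by positivity
  have hv1 : v ≤ 1 := by
    have : (N : ℝ) ^ (-β) ≤ 1 := Real.rpow_le_one_of_one_le_of_nonpos hN1 (by linarith)
    simp only [v]; nlinarith
  have hCv : (powerMap c γ)^[q] v = C * (N : ℝ) ^ (-B) := hC N hN0
  -- Half the height of the composed bumps, so that they range symmetrically around `1 / 2`.
  set δ := C * (N : ℝ) ^ (-B) / 2
  have hδ0 : 0 < δ := by positivity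
  have hB0 : 0 < B := by positivity
  have hNB : (N : ℝ) ^ (-B) ≤ 1 := Real.rpow_le_one_of_one_le_of_nonpos hN1 (by linarith)
  have hδ8 : δ ≤ 1 / 8 := by simp only [δ]; nlinarith
  set f : ((Fin m → Fin N) → Bool) → Cube d → ℝ := fun w x =>
    v * bumpSum w ((N : ℝ) • coords e x)
  have hfv : ∀ w x, 0 ≤ f w x ∧ f w x ≤ v := fun w x => by
    obtain ⟨h0, h1⟩ := bumpSum_mem_Icc w ((N : ℝ) • coords e x)
    exact ⟨mul_nonneg hv0.le h0, mul_le_of_le_one_right hv0.le h1⟩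
  have hfcont : ∀ w, Continuous (f w) := fun w => continuous_const.mul
    ((contDiff_bumpSum w).continuous.comp (by
      have := continuous_coords e
      fun_prop))
  have hfa : ∀ w a, 0 ≤ a → a ≤ 1 / 2 → (fun x => a + f w x) ∈ GH d m β r := fun w a ha ha' =>
    he β r _ (hball N hN w a r ha (by linarith))
  set η : ((Fin m → Fin N) → Bool) → Cube d → ℝ := fun w x =>
    (1 / 2 - δ) + (powerMap c γ)^[q] (f w x)
  have hrange : ∀ w x, η w x ∈ Set.Icc (1 / 2 - δ) (1 / 2 + δ) := by
    intro w x
    obtain ⟨h1, h2⟩ := powerMap_iterate_mono hc0.le hγ.le q (hfv w x).1 (hfv w x).2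
    rw [hCv] at h2
    simp only [η]
    constructor
    · linarith
    · have : C * (N : ℝ) ^ (-B) = 2 * δ := by simp only [δ]; ring
      linarith
  have hmem : ∀ w, η w ∈ GCH d q K m β r := by
    intro w
    have h0 := hfa w 0 le_rfl (by norm_num)
    simp only [zero_add] at h0
    exact const_add_powerMap_iterate_mem_GCH hm hmK hβ hc0.le (by linarith) (by linarith)
      (by linarith) h0 (hfa w _ (by linarith) (by linarith))
      fun x => ⟨(hfv w x).1, (hfv w x).2.trans hv1⟩
  have hplat : ∀ w j, ∀ x ∈ cellBox e j (1 / (8 * m)),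
      η w x = 1 / 2 - δ + (powerMap c γ)^[q] (v * if w j then 1 else 0) := by
    intro w j x hx
    simp only [η, f]
    rw [bumpSum_plateau w (norm_sub_cellCenter_le hm hx)]
  have ht : 1 / (8 * (m : ℝ)) ≤ 1 / 2 := by
    apply one_div_le_one_div_of_le <;> linarith
  have key := le_minimaxRisk_of_cells (n := n) η
    (fun w => (continuous_const.add
      ((continuous_powerMap_iterate hγ.le q).comp (hfcont w))).measurable)
    (S := fun j => cellBox e j (1 / (8 * m))) (B := fun j => cellBox e j (1 / 4))
    (fun j => measurableSet_cellBox e j _) (fun j => measurableSet_cellBox e j _)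
    (fun i j hij => Set.disjoint_left.2 fun x hi hj => hij
      (eq_of_norm_sub_cellCenter_le ((norm_sub_cellCenter_le hm hi).trans (by norm_num))
        ((norm_sub_cellCenter_le hm hj).trans (by norm_num))))
    hδ0.le (by linarith) hrange
    (fun w j hw x hx => by
      rw [hplat w j x hx, hw, if_pos rfl, mul_one, hCv]; simp only [δ]; ring)
    (fun w j hw x hx => by
      rw [hplat w j x hx, hw, if_neg (by simp), mul_zero, powerMap_iterate_zero hγ.ne', add_zero])
    (fun w j x hx => by
      simp only [η, f]; rw [bumpSum_update w j _ (le_norm_sub_cellCenter hx)])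
    (a := (2 * (1 / (8 * (m : ℝ))) / N) ^ m) (by positivity)
    (fun j => volume_cellBox e j (by positivity) ht)
    (b := (1 / (N : ℝ)) ^ m) (by positivity)
    (fun j => by
      rw [volume_cellBox e j (by norm_num) (by norm_num)]
      refine ENNReal.ofReal_le_ofReal ?_
      gcongr
      norm_num)
    (by
      -- With `2 δ = C N ^ (-B)` and `C ≤ 1 / 4`, the total divergence is at most `6 / 16` once `n ≤
      -- N ^ (m + 2 B)`.
      have e1 : (N : ℝ) ^ (-B) * (N : ℝ) ^ (-B) * (1 / (N : ℝ)) ^ m =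
          ((N : ℝ) ^ ((m : ℝ) + 2 * B))⁻¹ := by
        rw [one_div, inv_pow, ← Real.rpow_natCast, ← Real.rpow_neg hN0.le, ← Real.rpow_neg hN0.le,
          ← Real.rpow_add hN0, ← Real.rpow_add hN0]
        congr 1; ring
      have e2 : (n : ℝ) * ((N : ℝ) ^ ((m : ℝ) + 2 * B))⁻¹ ≤ 1 := by
        rw [← div_eq_mul_inv, div_le_one (by positivity)]; exact hnN
      calc (n : ℝ) * (6 * (2 * δ) ^ 2 * (1 / (N : ℝ)) ^ m)
          = 6 * C ^ 2 * (n * ((N : ℝ) ^ (-B) * (N : ℝ) ^ (-B) * (1 / (N : ℝ)) ^ m)) := by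
            simp only [δ]; ring
        _ ≤ 6 * (1 / 4) ^ 2 * 1 := by
            rw [e1]
            have : 0 ≤ (n : ℝ) * ((N : ℝ) ^ ((m : ℝ) + 2 * B))⁻¹ := by positivity
            gcongr
        _ ≤ 1 / 2 := by norm_num)
    (H := Model d q K m β r Λ)
    (fun w => ⟨η w, hmem w, fun x =>
      ⟨by linarith [(hrange w x).1], by linarith [(hrange w x).2]⟩, volume,
      volume_mem_boundedDensity d hΛ, rfl⟩)
  refine le_trans (le_of_eq ?_) key
  congr 1
  rw [Fintype.card_fun, Fintype.card_fin, Fintype.card_fin]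
  push_cast
  have e3 : (N : ℝ) ^ m * (2 * (1 / (8 * (m : ℝ))) / N) ^ m = (1 / (4 * (m : ℝ))) ^ m := by
    rw [← mul_pow]
    congr 1
    field_simp
    norm_num
  rw [e3]
  simp only [δ]
  ring

end Minimax

theorem theorem4p2 (q dstar : ℕ) (hdstar : 1 ≤ dstar) (β r : ℝ) (hβ : 0 < β) (hr : 1 / 2 < r) :
    ∃ c : ℝ, 0 < c ∧
      ∀ (d K : ℕ) (Λ : ℝ), 1 ≤ d → 1 ≤ K → 1 ≤ Λ → dstar * q ≤ K * q → dstar ≤ d →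
        ∀ n : ℕ, 1 ≤ n →
          ENNReal.ofReal
              (c * (1 / (n : ℝ)) ^ (β * (min 1 β) ^ q / ((dstar : ℝ) + 2 * (β * (min 1 β) ^ q)))) ≤
            Minimax.minimaxRisk n (Minimax.Model d q K dstar β r Λ) := by
  obtain ⟨C, hC0, hC⟩ := Minimax.exists_le_minimaxRisk_of_resolution q dstar hdstar hβ hr
  set B := β * (min 1 β) ^ q
  have hB : 0 < B := by
    have : 0 < min 1 β := lt_min zero_lt_one hβ
    positivity
  set D : ℝ := (dstar : ℝ) + 2 * B
  have hD : 0 < D := by positivity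
  refine ⟨C * 2 ^ (-B), by positivity, fun d K Λ _ _ hΛ hmK hmd n hn => ?_⟩
  have hn1 : (1 : ℝ) ≤ n := by exact_mod_cast hn
  have hn0 : (0 : ℝ) < n := by linarith
  -- The smallest admissible real resolution. Since `κ ≥ 1`, rounding up at most doubles it, which
  -- costs the factor `2 ^ (-B)`.
  set κ : ℝ := (n : ℝ) ^ (1 / D)
  have hκ : 1 ≤ κ := Real.one_le_rpow hn1 (by positivity)
  have hN : κ ≤ ⌈κ⌉₊ := Nat.le_ceil κ
  have hN1 : (1 : ℝ) ≤ ⌈κ⌉₊ := hκ.trans hN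
  have hN2 : (⌈κ⌉₊ : ℝ) ≤ 2 * κ := by
    have := Nat.ceil_lt_add_one (zero_le_one.trans hκ)
    linarith
  have hnD : (n : ℝ) ≤ (⌈κ⌉₊ : ℝ) ^ D := by
    calc (n : ℝ) = κ ^ D := by
          simp only [κ]
          rw [← Real.rpow_mul hn0.le, one_div_mul_cancel hD.ne', Real.rpow_one]
      _ ≤ _ := by gcongr
  refine le_trans (ENNReal.ofReal_le_ofReal ?_)
    (hC d K Λ hΛ hmK hmd n ⌈κ⌉₊ (by exact_mod_cast hN1) hnD)
  rw [mul_assoc]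
  refine mul_le_mul_of_nonneg_left ?_ hC0.le
  calc (2 : ℝ) ^ (-B) * (1 / (n : ℝ)) ^ (B / D) = (2 * κ) ^ (-B) := by
        rw [Real.mul_rpow (by norm_num) (by positivity)]
        simp only [κ]
        rw [← Real.rpow_mul hn0.le, one_div, Real.inv_rpow hn0.le, ← Real.rpow_neg hn0.le]
        congr 2
        ring
    _ ≤ (⌈κ⌉₊ : ℝ) ^ (-B) :=
        Real.rpow_le_rpow_of_nonpos (by linarith) hN2 (by linarith)
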